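/- **Setting.** Let $q$ be an odd prime power and $t\ge 5$. For $d\mid 2t$, $\mathbb F_{q^d}$ denotes the subfield of $\mathbb F_{q^{2t}}$ with $q^d$ elements; $\mathrm{Tr}(x)=x+x^{q^t}$ and $\mathrm N(x)=x^{q^t+1}$ are the trace and norm of $\mathbb F_{q^{2t}}$ over $\mathbb F_{q^t}$. For a positive integer $s$ with $\gcd(s,2t)=1$, $m\in\mathbb F_{q^t}^*$ and $h\in\mathbb F_{q^{2t}}^*$ let $$\psi_{m,h,s}=m\bigl(X^{q^s}-h^{1-q^{s(t+1)}}X^{q^{s(t+1)}}\bigr)+X^{q^{s(t-1)}}+h^{1-q^{s(2t-1)}}X^{q^{s(2t-1)}},$$ and let $$\mathscr P^{\pm}_s=\{w^{q^s\pm1}\in\mathbb F_{q^t}: w\in\mathbb F_{q^{2t}},\ \mathrm{Tr}(w)=0\}.$$ Call $(m,h)$ *admissible for $s$* if one of the following holds: * (i) $t$ is even, or $t$ is odd and $q\equiv1\pmod 4$; and $m\in\mathbb F_{q^t}^*\setminus(\mathscr P^+_s\cup\mathscr P^-_s)$, $\mathrm N(h)=\pm1$; * (ii) $t$ is odd, $q\equiv3\pmod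 4$, and either $m\in\mathscr P^+_s\setminus\{0\}$ and $\mathrm N(h)=-1$, or $m\in\mathbb F_{q^t}^*\setminus(\mathscr P^+_s\cup\mathscr P^-_s)$, $\mathrm N(h)=1$ and $h^2\ne-1$. For a polynomial $f$ over $\mathbb F_{q^{2t}}$ put $U_f=\{(x,f(x)):x\in\mathbb F_{q^{2t}}\}\subseteq\mathbb F_{q^{2t}}^2$, and write $f\sim_{\mathrm{GL}}g$ if $U_f$ and $U_g$ lie in the same orbit of $\mathrm{GL}(2,q^{2t})$. **Theorem.** Let $s,\ell$ be positive integers with $\gcd(s,2t)=\gcd(\ell,2t)=1$, let $(m,h)$ be admissible for $s$ and $(\mu,k)$ admissible for $\ell$. Put $d=\gcd(t-2,2t)$. * (a) If $\ell\not\equiv\pm s$ and $\ell\not\equiv t\pm s\pmod{2t}$, then $\psi_{m,h,s}\not\sim_{\mathrm{GL}}\psi_{\mu,k,\ell}$. Now suppose $\psi_{m,h,s}\sim_{\mathrm{GL}}\psi_{\mu,k,\ell}$. * (b) If $\ell\equiv-s\pmod{2t}$, then $\xi:=hk\in\mathbb F_{q^d}$ and there is $z\in\mathbb F_{q^{2t}}$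 such that either $z^{q^{st}}=\xi^{q^{3s}-1}z$ and $m\mu^{q^s}=z^{q^{s(t-2)}-1}$, or $z^{q^{st}}=-\xi^{q^{3s}-1}z$ and $m\mu=-z^{q^{s(t-2)}-1}$. * (c) If $\ell\equiv s\pmod{2t}$, then $\xi:=h/k\in\mathbb F_{q^d}$ and there is $z\in\mathbb F_{q^{2t}}$ such that either $z^{q^{st}}=-\xi^{q^{3s}-1}z$ and $m\mu^{-q^{s(t-1)}}=-z^{q^{s(t-2)}-1}$, or $z^{q^{st}}=\xi^{q^{3s}-1}z$ and $m/\mu=z^{q^{s(t-2)}-1}$. * (d) If $\ell\equiv t-s\pmod{2t}$, then $\xi:=h/k\in\mathbb F_{q^d}$ and there is $z\in\mathbb F_{q^{2t}}$ such that either $z^{q^{st}}=\xi^{q^{3s}-1}z$ and $m\mu^{q^s}=-z^{q^{s(t-2)}-1}$, or $z^{q^{st}}=-\xi^{q^{3s}-1}z$ and $m\mu=z^{q^{s(t-2)}-1}$. * (e) If $\ell\equiv t+s\pmod{2t}$, then $\xi:=hk\in\mathbb F_{q^d}$ and there is $z\in\mathbb F_{q^{2t}}$ such that either $z^{q^{st}}=-\xi^{q^{3s}-1}z$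 and $m\mu^{-q^{s(t-1)}}=z^{q^{s(t-2)}-1}$, or $z^{q^{st}}=\xi^{q^{3s}-1}z$ and $m/\mu=-z^{q^{s(t-2)}-1}$. -/

import Mathlib

open Polynomial

namespace ScatteredQuad

noncomputable section

/-- Inside a finite field `K` with `q ^ n` elements and for a divisor `d` of `n`, this is the subfield
with `q ^ d` elements. -/
def subF (K : Type*) [Field K] (q d : ℕ) : Set K :=
  {x | x ^ q ^ d = x}

/-- The trace of the field with `q ^ n` elements over its subfield with `q ^ d` elements (`d ∣ n`). -/
def tr {K : Type*} [Field K] (q n d : ℕ) (x : K) : K :=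
  ∑ i ∈ Finset.range (n / d), x ^ q ^ (d * i)

/-- The norm of the field with `q ^ n` elements over its subfield with `q ^ d` elements (`d ∣ n`);
the division of exponents is exact. -/
def nm {K : Type*} [Field K] (q n d : ℕ) (x : K) : K :=
  x ^ ((q ^ n - 1) / (q ^ d - 1))

/-- The `(q ^ s + 1)`-th powers, lying in the field with `q ^ t` elements, of the elements of trace
zero. -/
def PPlus (K : Type*) [Field K] (q t s : ℕ) : Set K :=
  {y | y ∈ subF K q t ∧ ∃ w : K, tr q (2 * t) t w = 0 ∧ w ^ (q ^ s + 1) = y}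

/-- The `(q ^ s - 1)`-th powers, lying in the field with `q ^ t` elements, of the elements of trace
zero. -/
def PMinus (K : Type*) [Field K] (q t s : ℕ) : Set K :=
  {y | y ∈ subF K q t ∧ ∃ w : K, tr q (2 * t) t w = 0 ∧ w ^ (q ^ s - 1) = y}

/-- The quadrinomial `ψ_{m,h,s}` (used for `h ≠ 0` only). -/
def psi {K : Type*} [Field K] (q t : ℕ) (m h : K) (s : ℕ) : K[X] :=
  C m * (X ^ q ^ s - C (h ^ (1 - (q : ℤ) ^ (s * (t + 1)))) * X ^ q ^ (s * (t + 1)))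
    + X ^ q ^ (s * (t - 1))
    + C (h ^ (1 - (q : ℤ) ^ (s * (2 * t - 1)))) * X ^ q ^ (s * (2 * t - 1))

/-- The conditions on `(m, h)` under which `ψ_{m,h,s}` is considered; `m` lies in the
multiplicative group of the field with `q ^ t` elements. -/
def Admissible {K : Type*} [Field K] (q t : ℕ) (m h : K) (s : ℕ) : Prop :=
  m ∈ subF K q t ∧ m ≠ 0 ∧
    (((Even t ∨ (Odd t ∧ q % 4 = 1)) ∧
        m ∉ PPlus K q t s ∪ PMinus K q t s ∧
        (nm q (2 * t) t h = 1 ∨ nm q (2 * t) t h = -1)) ∨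
      ((Odd t ∧ q % 4 = 3) ∧
        ((m ∈ PPlus K q t s ∧ nm q (2 * t) t h = -1) ∨
          (m ∉ PPlus K q t s ∪ PMinus K q t s ∧ nm q (2 * t) t h = 1 ∧ h ^ 2 ≠ -1))))

/-- The set `U_f` of all vectors `(x, f(x))` in the plane over `K`. -/
def graphSet {K : Type*} [Field K] (f : K[X]) : Set (Fin 2 → K) :=
  Set.range fun x : K => ![x, f.eval x]

/-- `f` and `g` are GL-equivalent: `U_f` and `U_g` lie in one orbit of `GL(2, K)`. -/
def GLEquiv {K : Type*} [Field K] (f g : K[X]) : Prop :=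
  ∃ A : Matrix.GeneralLinearGroup (Fin 2) K,
    (fun v : Fin 2 → K => (A : Matrix (Fin 2) (Fin 2) K).mulVec v) '' graphSet f = graphSet g

end

end ScatteredQuad

/-! ### Separating residue classes of Frobenius exponents -/

namespace ScatteredQuad

/-! Write `S` for the `q^s`-Frobenius, `P` for its inverse and `T` for `x ↦ x^(q^t)`. Since `s` is
odd, `T = S^t`, and `N(h) = ε = ±1` means `T h = ε / h`. Then `ψ(x) = m (S x - ε h S(h) T S x) + (h
/ P h) P x + T P x`: the exponents occupy only the classes `±s` modulo `t`, with two exponents in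
each. Equivalence means `φ(a x + b ψ(x)) = c x + d ψ(x)` with `ad - bc ≠ 0`, and by independence of
characters this identity splits into one identity for each class modulo `t` (`class_separation`).

If `ℓ ≢ ±s` modulo `t`, class `0` forces `c = 0`, hence `d ≠ 0`. On the kernel of the `-s` part of
`ψ`, class `s` then forces the `s` part to vanish as well. That kernel can be parametrized, and the
vanishing contradicts `1 + ε h S(S h) ≠ 0` (`not_planeEquiv`). This inequality is where the
exclusion of `h² = -1` enters (`one_add_mul_ne_zero`).

If `ℓ ≡ ±s` modulo `t`, exponents are measured in units of `s`. As `t ≥ 5`, the classes `-2, ..., 2`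
are distinct. For `b = 0`, classes `±1` link `a` and `d`; for `b ≠ 0`, classes `±2` and the `T` half
of class `0` involve `b` alone. Either way, eliminating the unknown gives `S(S ξ) = T ξ` and an
explicit `z`. With `T = S^t`, the first relation says that `S^(t-2)` fixes `ξ`, which places `ξ` in
the field with `q^d` elements. Rescaling the plane brings all four congruences modulo `2t` to this
one computation, with a sign `θ` and with `k`, `μ` possibly inverted. -/

/-- Dedekind's independence of characters. Because `t` divides the order of `F`, the class of an
exponent modulo `t` depends only on the automorphism. -/
theorem sum_zpow_class_eq_zero {K : Type*} [Field K] (F : RingAut K) {N t : ℕ} (hF : orderOf F = N)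
    (htN : t ∣ N) {ι : Type*} [Fintype ι] (c : ι → K) (e : ι → ℤ)
    (H : ∀ x, ∑ i, c i * (F ^ e i) x = 0) (n : ℤ) (x : K) :
    ∑ i, (if (t : ℤ) ∣ e i - n then c i * (F ^ e i) x else 0) = 0 := by
  classical
  let f : ι → (K →* K) := fun i => ((F ^ e i : RingAut K) : K →* K)
  let p : (K →* K) → Prop := fun g => ∃ j : ℤ, (t : ℤ) ∣ j - n ∧ g = ((F ^ j : RingAut K) : K →* K)
  have hp : ∀ i, p (f i) ↔ (t : ℤ) ∣ e i - n := by
    intro i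
    constructor
    · rintro ⟨j, hj, hij⟩
      have h1 : F ^ e i = F ^ j := by
        ext y
        exact DFunLike.congr_fun hij y
      have h2 : (N : ℤ) ∣ e i - j := by
        rw [← hF]
        apply orderOf_dvd_iff_zpow_eq_one.mpr
        rw [zpow_sub, h1, mul_inv_cancel]
      have h3 : (t : ℤ) ∣ e i - j := (Int.natCast_dvd_natCast.mpr htN).trans h2
      have := dvd_add h3 hj
      simpa using this
    · intro h
      exact ⟨e i, h, rfl⟩
  -- The exponents may repeat, so the coefficients are first collected by automorphism; independence
  -- then applies to the collected sum.
  let L : (K →* K) →₀ K := ∑ i, Finsupp.single (f i) (c i)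
  have hL : L = 0 := by
    apply (linearIndependent_iff.mp (linearIndependent_monoidHom K K)) L
    funext y
    simp only [L, map_sum, Finsupp.linearCombination_single, Finset.sum_apply, Pi.smul_apply,
      smul_eq_mul, Pi.zero_apply]
    exact H y
  have h1 : Finsupp.linearCombination K (fun g : K →* K => (g : K → K)) (L.filter p) x = 0 := by
    rw [hL, Finsupp.filter_zero, map_zero, Pi.zero_apply]
  have h2 : L.filter p = ∑ i, (if p (f i) then Finsupp.single (f i) (c i) else 0) := by
    have hs : L.filter p = ∑ i, (Finsupp.single (f i) (c i)).filter p :=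
      map_sum (Finsupp.filterAddHom p : ((K →* K) →₀ K) →+ ((K →* K) →₀ K)) _ _
    rw [hs]
    refine Finset.sum_congr rfl fun i _ => ?_
    split_ifs with h
    · exact Finsupp.filter_single_of_pos _ h
    · exact Finsupp.filter_single_of_neg _ h
  rw [h2, map_sum, Finset.sum_apply] at h1
  refine Eq.trans ?_ h1
  refine Finset.sum_congr rfl fun i _ => ?_
  by_cases h : (t : ℤ) ∣ e i - n
  · rw [if_pos h, if_pos ((hp i).mpr h)]
    simp [f]
  · rw [if_neg h, if_neg (fun h' => h ((hp i).mp h'))]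
    simp

theorem sum_pair_class_eq_zero {K : Type*} [Field K] (F : RingAut K) {t : ℕ}
    (hF : orderOf F = 2 * t) {ι : Type*} [Fintype ι] (u v : ι → K) (e : ι → ℤ)
    (H : ∀ x, ∑ i, (u i * (F ^ e i) x + v i * (F ^ (t : ℤ)) ((F ^ e i) x)) = 0) (n : ℤ) (x : K) :
    ∑ i, (if (t : ℤ) ∣ e i - n then
      u i * (F ^ e i) x + v i * (F ^ (t : ℤ)) ((F ^ e i) x) else 0) = 0 := by
  have h := sum_zpow_class_eq_zero F (t := t) hF (Dvd.intro_left 2 rfl) (ι := ι ⊕ ι)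
    (Sum.elim u v) (Sum.elim e fun i => t + e i) (by
      intro y
      rw [Fintype.sum_sum_type, ← Finset.sum_add_distrib]
      simpa [zpow_add] using H y) n x
  rw [Fintype.sum_sum_type, ← Finset.sum_add_distrib] at h
  refine Eq.trans ?_ h
  refine Finset.sum_congr rfl fun i _ => ?_
  have : (t : ℤ) ∣ t + e i - n ↔ (t : ℤ) ∣ e i - n := by
    rw [add_sub_assoc]
    exact dvd_add_right (dvd_refl _)
  simp only [Sum.elim_inl, Sum.elim_inr, this]
  split_ifs with hi
  · simp [hi, zpow_add]
  · simp [hi]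

/-- The two members of a residue class modulo `t` of a `q`-polynomial. -/
def pairTerm {K : Type*} [Field K] (F : RingAut K) (t : ℕ) (u v : K) (e : ℤ) (x : K) : K :=
  u * (F ^ e) x + v * (F ^ (t : ℤ)) ((F ^ e) x)

theorem pairTerm_eq_zero {K : Type*} [Field K] {F : RingAut K} {t : ℕ}
    (hT : F ^ (t : ℤ) ≠ 1) {u v : K} {e : ℤ} (H : ∀ x, pairTerm F t u v e x = 0) :
    u = 0 ∧ v = 0 := by
  have H' : ∀ y, u * y + v * (F ^ (t : ℤ)) y = 0 := by
    intro y
    have := H ((F ^ (-e)) y)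
    rwa [pairTerm, ← RingAut.mul_apply (F ^ e), ← zpow_add, add_neg_cancel, zpow_zero,
      RingAut.one_apply] at this
  have h1 : u + v = 0 := by simpa using H' 1
  obtain ⟨y, hy⟩ : ∃ y, (F ^ (t : ℤ)) y ≠ y := by
    by_contra! hc
    exact hT (RingEquiv.ext hc)
  have h2 : v * ((F ^ (t : ℤ)) y - y) = 0 := by linear_combination H' y - y * h1
  have hv : v = 0 := (mul_eq_zero.mp h2).resolve_right (sub_ne_zero.mpr hy)
  exact ⟨by rw [hv, add_zero] at h1; exact h1, hv⟩

/-- Separation modulo `t` of the exponents in `φ(a x + b ψ(x)) = c x + d ψ(x)`. -/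
theorem class_separation {K : Type*} [Field K] (F : RingAut K) {t : ℕ}
    (hF : orderOf F = 2 * t) (s l : ℤ) (α₀ α₁ β₀ β₁ A₀ A₁ B₀ B₁ a b c d : K) (φ ψ : K → K)
    (hψ : ∀ x, ψ x = pairTerm F t α₀ α₁ s x + pairTerm F t β₀ β₁ (-s) x)
    (hφ : ∀ x, φ x = pairTerm F t A₀ A₁ l x + pairTerm F t B₀ B₁ (-l) x)
    (H : ∀ x, φ (a * x + b * ψ x) = c * x + d * ψ x) (n : ℤ) (x : K) :
    (if (t : ℤ) ∣ l - n then
        pairTerm F t (A₀ * (F ^ l) a) (A₁ * (F ^ (t : ℤ)) ((F ^ l) a)) l x else 0) +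
    (if (t : ℤ) ∣ -l - n then
        pairTerm F t (B₀ * (F ^ (-l)) a) (B₁ * (F ^ (t : ℤ)) ((F ^ (-l)) a)) (-l) x else 0) +
    (if (t : ℤ) ∣ l + s - n then
        pairTerm F t (A₀ * (F ^ l) (b * α₀) + A₁ * (F ^ (t : ℤ)) ((F ^ l) (b * α₁)))
          (A₀ * (F ^ l) (b * α₁) + A₁ * (F ^ (t : ℤ)) ((F ^ l) (b * α₀))) (l + s) x else 0) +
    (if (t : ℤ) ∣ l - s - n then
        pairTerm F t (A₀ * (F ^ l) (b * β₀) + A₁ * (F ^ (t : ℤ)) ((F ^ l) (b * β₁)))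
          (A₀ * (F ^ l) (b * β₁) + A₁ * (F ^ (t : ℤ)) ((F ^ l) (b * β₀))) (l - s) x else 0) +
    (if (t : ℤ) ∣ -l + s - n then
        pairTerm F t (B₀ * (F ^ (-l)) (b * α₀) + B₁ * (F ^ (t : ℤ)) ((F ^ (-l)) (b * α₁)))
          (B₀ * (F ^ (-l)) (b * α₁) + B₁ * (F ^ (t : ℤ)) ((F ^ (-l)) (b * α₀))) (-l + s) x
        else 0) +
    (if (t : ℤ) ∣ -l - s - n then
        pairTerm F t (B₀ * (F ^ (-l)) (b * β₀) + B₁ * (F ^ (t : ℤ)) ((F ^ (-l)) (b * β₁)))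
          (B₀ * (F ^ (-l)) (b * β₁) + B₁ * (F ^ (t : ℤ)) ((F ^ (-l)) (b * β₀))) (-l - s) x
        else 0) +
    (if (t : ℤ) ∣ 0 - n then pairTerm F t (-c) 0 0 x else 0) +
    (if (t : ℤ) ∣ s - n then pairTerm F t (-(d * α₀)) (-(d * α₁)) s x else 0) +
    (if (t : ℤ) ∣ -s - n then pairTerm F t (-(d * β₀)) (-(d * β₁)) (-s) x else 0) = 0 := by
  have hTT : ∀ y, (F ^ (t : ℤ)) ((F ^ (t : ℤ)) y) = y := by
    intro y
    rw [← RingAut.mul_apply, ← zpow_add]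
    have : F ^ ((t : ℤ) + t) = 1 := by
      apply orderOf_dvd_iff_zpow_eq_one.mp
      rw [hF]; push_cast; rw [two_mul]
    rw [this, RingAut.one_apply]
  have hcomm : ∀ (e : ℤ) y, (F ^ e) ((F ^ (t : ℤ)) y) = (F ^ (t : ℤ)) ((F ^ e) y) := by
    intro e y
    rw [← RingAut.mul_apply, ← RingAut.mul_apply, ← zpow_add, ← zpow_add, add_comm]
  have hadd : ∀ (e f : ℤ) y, (F ^ (e + f)) y = (F ^ e) ((F ^ f) y) := by
    intro e f y
    rw [zpow_add, RingAut.mul_apply]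
  have key := sum_pair_class_eq_zero F hF (ι := Fin 9)
    ![A₀ * (F ^ l) a, B₀ * (F ^ (-l)) a,
      A₀ * (F ^ l) (b * α₀) + A₁ * (F ^ (t : ℤ)) ((F ^ l) (b * α₁)),
      A₀ * (F ^ l) (b * β₀) + A₁ * (F ^ (t : ℤ)) ((F ^ l) (b * β₁)),
      B₀ * (F ^ (-l)) (b * α₀) + B₁ * (F ^ (t : ℤ)) ((F ^ (-l)) (b * α₁)),
      B₀ * (F ^ (-l)) (b * β₀) + B₁ * (F ^ (t : ℤ)) ((F ^ (-l)) (b * β₁)),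
      -c, -(d * α₀), -(d * β₀)]
    ![A₁ * (F ^ (t : ℤ)) ((F ^ l) a), B₁ * (F ^ (t : ℤ)) ((F ^ (-l)) a),
      A₀ * (F ^ l) (b * α₁) + A₁ * (F ^ (t : ℤ)) ((F ^ l) (b * α₀)),
      A₀ * (F ^ l) (b * β₁) + A₁ * (F ^ (t : ℤ)) ((F ^ l) (b * β₀)),
      B₀ * (F ^ (-l)) (b * α₁) + B₁ * (F ^ (t : ℤ)) ((F ^ (-l)) (b * α₀)),
      B₀ * (F ^ (-l)) (b * β₁) + B₁ * (F ^ (t : ℤ)) ((F ^ (-l)) (b * β₀)),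
      0, -(d * α₁), -(d * β₁)]
    ![l, -l, l + s, l + -s, -l + s, -l + -s, 0, s, -s] (by
      intro y
      have h := H y
      rw [hφ, hψ] at h
      simp only [pairTerm, map_add, map_mul, hcomm, hTT] at h
      simp only [Fin.sum_univ_succ, Fin.sum_univ_zero, Matrix.cons_val_zero, Matrix.cons_val_succ,
        hadd, map_mul, zpow_zero, RingAut.one_apply]
      linear_combination h) n x
  simp only [Fin.sum_univ_succ, Fin.sum_univ_zero, Matrix.cons_val_zero,
    Matrix.cons_val_succ] at key
  simp only [pairTerm, sub_eq_add_neg] at key ⊢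
  linear_combination key

/-! ### Eliminating the matrix entries when `ℓ ≡ ±s` modulo `t` -/

section Core

variable {K : Type*} [Field K]

/-- The four hypotheses compare the coefficients of the two exponents in classes `1` and `-1` when
`b = 0`. Two expressions for `T (S a)` must agree, which removes `a`. -/
theorem diagonal_case (S P T : K →+* K) (hSP : ∀ x, S (P x) = x) (hPS : ∀ x, P (S x) = x)
    (hTS : ∀ x, T (S x) = S (T x)) {m h μ k ε η θ : K}
    (hε : ε = 1 ∨ ε = -1) (hη : η = 1 ∨ η = -1) (hθ : θ = 1 ∨ θ = -1)
    (hh : h ≠ 0) (hk : k ≠ 0) (hμ : μ ≠ 0)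
    (hTh : T h = ε / h) (hTk : T k = η / k) {a d : K} (ha : a ≠ 0)
    (h1 : μ * S a = d * m)
    (h2 : -(μ * θ * η * k * S k) * T (S a) = d * -(m * ε * h * S h))
    (h3 : θ * (k / P k) * P a = d * (h / P h)) (h4 : T (P a) = d) :
    S (S (h / k)) = T (h / k) ∧
      ∃ z : K, z ≠ 0 ∧ T z = θ * (S (S (S (h / k))) / (h / k)) * z ∧ m / μ = T (P (P z)) / z := by
  have hε2 : ε * ε = 1 := by rcases hε with rfl | rfl <;> ring
  have hη2 : η * η = 1 := by rcases hη with rfl | rfl <;> ring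
  have hθ2 : θ * θ = 1 := by rcases hθ with rfl | rfl <;> ring
  have Sε : S ε = ε := by rcases hε with rfl | rfl <;> simp
  have Sη : S η = η := by rcases hη with rfl | rfl <;> simp
  have Sθ : S θ = θ := by rcases hθ with rfl | rfl <;> simp
  have S0 : ∀ {x : K}, x ≠ 0 → S x ≠ 0 := fun hx => (map_ne_zero S).mpr hx
  have P0 : ∀ {x : K}, x ≠ 0 → P x ≠ 0 := fun hx => (map_ne_zero P).mpr hx
  have T0 : ∀ {x : K}, x ≠ 0 → T x ≠ 0 := fun hx => (map_ne_zero T).mpr hx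
  have hε0 : ε ≠ 0 := left_ne_zero_of_mul_eq_one hε2
  have hη0 : η ≠ 0 := left_ne_zero_of_mul_eq_one hη2
  have hθ0 : θ ≠ 0 := left_ne_zero_of_mul_eq_one hθ2
  have hSa := S0 ha
  have hSh := S0 hh
  have hSk := S0 hk
  have hSSk := S0 hSk
  have hd : d ≠ 0 := by
    rintro rfl
    exact mul_ne_zero hμ hSa (by simpa using h1)
  have e2 : k * S k * T (S a) = θ * (ε * η) * (h * S h) * S a := by
    have h5 : μ * (θ * η * k * S k * T (S a)) = μ * (S a * ε * h * S h) := by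
      linear_combination -h2 - ε * h * S h * h1
    have h6 := mul_left_cancel₀ hμ h5
    linear_combination θ * η * h6 - (k * S k * T (S a)) * (η * η * hθ2 + hη2)
  have e4 : T a * (S h * k) = θ * S k * h * a := by
    have h5 : S (T (P a)) = S d := by rw [h4]
    rw [← hTS, hSP] at h5
    have h6 := congrArg S h3
    simp only [map_mul, map_div₀, hSP, Sθ] at h6
    rw [← h5] at h6
    field_simp at h6
    linear_combination -h6
  have e5 := congrArg S e4
  simp only [map_mul, Sθ, ← hTS] at e5
  -- This is `S (S (h / k)) = T (h / k)` with denominators cleared.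
  have R : k * S (S k) = ε * η * (h * S (S h)) := by
    have h7 : (θ * S h * S a) * (k * S (S k)) = (θ * S h * S a) * (ε * η * (h * S (S h))) := by
      linear_combination S (S h) * e2 - k * e5
    exact mul_left_cancel₀ (mul_ne_zero (mul_ne_zero hθ0 hSh) hSa) h7
  have hTq : T (h / k) = ε * η * (k / h) := by
    rw [map_div₀, hTh, hTk]
    field_simp
    linear_combination -hη2
  have hSSq : S (S (h / k)) = T (h / k) := by
    rw [hTq, map_div₀, map_div₀]
    field_simp
    linear_combination -(ε * η) * R - (h * S (S h)) * (η * η * hε2 + hη2)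
  -- By `h4`, `T (P (P z)) = 1 / d` for this `z`, so the ratio is `S a / d`, which is `m / μ` by
  -- `h1`.
  refine ⟨hSSq, (S a)⁻¹, inv_ne_zero hSa, ?_, ?_⟩
  · have hTSa : T (S a) ≠ 0 := T0 hSa
    rw [hSSq, hTq, map_inv₀]
    simp only [map_mul, map_div₀, Sε, Sη]
    field_simp
    linear_combination θ * (ε * η) * e2 * (-1 : K) +
      h * S h * S a * (θ * θ * ε * ε * hη2 + θ * θ * hε2 + hθ2) * (-1 : K)
  · rw [map_inv₀, map_inv₀, map_inv₀, hPS, h4]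
    field_simp
    linear_combination -h1

/-- `h1` and `h2` are one coefficient from each of the classes `2` and `-2`, and suffice to
eliminate `b`. `h3` is the `T` coefficient of class `0`, which `c` does not enter; it supplies the
formula for `m`. -/
theorem antidiagonal_case (S P T : K →+* K) (hSP : ∀ x, S (P x) = x) (hPS : ∀ x, P (S x) = x)
    (hTS : ∀ x, T (S x) = S (T x)) {m h μ k ε η θ : K}
    (hε : ε = 1 ∨ ε = -1) (hη : η = 1 ∨ η = -1) (hθ : θ = 1 ∨ θ = -1)
    (hh : h ≠ 0) (hk : k ≠ 0) (hm : m ≠ 0) (hμ : μ ≠ 0)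
    (hTh : T h = ε / h) (hTk : T k = η / k) (hTm : T m = m) (hTμ : T μ = μ)
    (hκ : 1 + ε * (h * S (S h)) ≠ 0) {b : K} (hb : b ≠ 0)
    (h1 : μ * S (b * m) + -(μ * θ * η * k * S k) * T (S (b * -(m * ε * h * S h))) = 0)
    (h2 : θ * (k / P k) * P (b * 1) + 1 * T (P (b * (h / P h))) = 0)
    (h3 : μ * S (b * 1) + -(μ * θ * η * k * S k) * T (S (b * (h / P h))) +
      (θ * (k / P k) * P (b * -(m * ε * h * S h)) + 1 * T (P (b * m))) = 0) :
    S (S (h / k)) = T (h / k) ∧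
      ∃ z : K, z ≠ 0 ∧ T z = -θ * (S (S (S (h / k))) / (h / k)) * z ∧
        m / P μ = -(T (P (P z)) / z) := by
  have hε2 : ε * ε = 1 := by rcases hε with rfl | rfl <;> ring
  have hη2 : η * η = 1 := by rcases hη with rfl | rfl <;> ring
  have hθ2 : θ * θ = 1 := by rcases hθ with rfl | rfl <;> ring
  have Sε : S ε = ε := by rcases hε with rfl | rfl <;> simp
  have Sη : S η = η := by rcases hη with rfl | rfl <;> simp
  have Sθ : S θ = θ := by rcases hθ with rfl | rfl <;> simp
  have Pε : P ε = ε := by rcases hε with rfl | rfl <;> simp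
  have Tε : T ε = ε := by rcases hε with rfl | rfl <;> simp
  have hTP : ∀ x, T (P x) = P (T x) := fun x => by
    rw [← hPS (T (P x)), ← hTS, hSP]
  have S0 : ∀ {x : K}, x ≠ 0 → S x ≠ 0 := fun hx => (map_ne_zero S).mpr hx
  have P0 : ∀ {x : K}, x ≠ 0 → P x ≠ 0 := fun hx => (map_ne_zero P).mpr hx
  have T0 : ∀ {x : K}, x ≠ 0 → T x ≠ 0 := fun hx => (map_ne_zero T).mpr hx
  have hε0 : ε ≠ 0 := left_ne_zero_of_mul_eq_one hε2
  have hη0 : η ≠ 0 := left_ne_zero_of_mul_eq_one hη2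
  have hθ0 : θ ≠ 0 := left_ne_zero_of_mul_eq_one hθ2
  have hSb := S0 hb
  have hSSb := S0 hSb
  have hSh := S0 hh
  have hSSh := S0 hSh
  have hSSSh := S0 hSSh
  have hPh := P0 hh
  have hSk := S0 hk
  have hSSk := S0 hSk
  have hSm := S0 hm
  have hSμ := S0 hμ
  have hPμ := P0 hμ
  have hTb := T0 hb
  have hTSh : T (S h) = ε / S h := by rw [hTS, hTh, map_div₀, Sε]
  have hTSSh : T (S (S h)) = ε / S (S h) := by rw [hTS, hTSh, map_div₀, Sε]
  have hTSSSh : T (S (S (S h))) = ε / S (S (S h)) := by rw [hTS, hTSSh, map_div₀, Sε]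
  have hTPh : T (P h) = ε / P h := by rw [hTP, hTh, map_div₀, Pε]
  have e1 : k * S k * T (S b) = -(θ * (ε * η)) * (S b * S h * S (S h)) := by
    simp only [map_mul, map_neg, hTSh, hTSSh, Sε, Tε] at h1
    rw [hTS m, hTm] at h1
    have h5 : (μ * S m) * (S b * S h * S (S h) + θ * (ε * η) * (k * S k * T (S b))) = 0 := by
      field_simp at h1
      linear_combination h1 - μ * S m * θ * η * k * S k * T (S b) * ε * hε2
    have h6 := (mul_eq_zero.mp h5).resolve_left (mul_ne_zero hμ hSm)
    linear_combination θ * (ε * η) * h6 -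
      (k * S k * T (S b)) * (θ * θ * ε * ε * hη2 + θ * θ * hε2 + hθ2)
  have e2 : k * P h * T b = - (θ * S k * b * h) := by
    have h6 := congrArg S h2
    simp only [map_add, mul_one, one_mul, map_mul, map_div₀, hSP, Sθ, Sε, map_zero, ← hTS, hTPh]
      at h6
    field_simp at h6
    linear_combination h6
  have e3 := congrArg S e2
  have e4 := congrArg S e1
  simp only [map_mul, map_neg, Sθ, Sε, Sη, ← hTS, hSP] at e3 e4
  have R : k * S (S k) = ε * η * (h * S (S h)) := by
    have h7 : (θ * S h * S b) * (k * S (S k)) = (θ * S h * S b) * (ε * η * (h * S (S h))) := by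
      linear_combination k * e3 - h * e1
    exact mul_left_cancel₀ (mul_ne_zero (mul_ne_zero hθ0 hSh) hSb) h7
  have hTq : T (h / k) = ε * η * (k / h) := by
    rw [map_div₀, hTh, hTk]
    field_simp
    linear_combination -hη2
  have hSSq : S (S (h / k)) = T (h / k) := by
    rw [hTq, map_div₀, map_div₀]
    field_simp
    linear_combination -(ε * η) * R - (h * S (S h)) * (η * η * hε2 + hη2)
  -- `w` and `v = P (P w)` are the factors left in `h3` after substituting `e2` and `e4`. `T`
  -- multiplies each by an explicit factor (`hTw`, `hTv`), and `hκ` keeps them nonzero.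
  set w : K := 1 + ε * (S h * S (S (S h))) with hw
  have hw0 : w ≠ 0 := by
    have := S0 hκ
    simpa only [map_add, map_one, map_mul, Sε] using this
  set v : K := 1 + ε * (P h * S h) with hv
  have hPPw : P (P w) = v := by
    simp only [hw, hv, map_add, map_one, map_mul, hPS, Pε]
  have hv0 : v ≠ 0 := hPPw ▸ P0 (P0 hw0)
  have hTw : T w * (S h * S (S (S h))) = ε * w := by
    rw [hw]
    simp only [map_add, map_one, map_mul, Tε, hTSh, hTSSSh]
    field_simp
    linear_combination (ε - S h * S (S (S h))) * hε2
  have hTv : T v * (P h * S h) = ε * v := by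
    rw [hv]
    simp only [map_add, map_one, map_mul, Tε, hTSh, hTPh]
    field_simp
    linear_combination (ε - P h * S h) * hε2
  have G : S μ * S (S b) * w = -(m * T b * v) := by
    have h6 := congrArg S h3
    simp only [map_add, map_neg, mul_one, one_mul, map_mul, map_div₀, hSP, Sθ, Sη, map_zero,
      ← hTS, hTh, hTm, hTSh, Sε] at h6
    field_simp at h6
    refine mul_left_cancel₀ (mul_ne_zero hk hSSh) ?_
    linear_combination h6 + S μ * k * θ * η * S h * e4 + S (S h) * m * ε * S h * e2 -
      k * S (S h) * S μ * S (S b) * ε * S h * S (S (S h)) * (θ * θ * hη2 + hθ2)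
  have hPPq : T (P (P (h / k))) = h / k := by
    rw [hTP, hTP, ← hSSq, hPS, hPS]
  -- `G` makes `m / P μ` a ratio of `S (S b) * w * S μ` to its image under `P ∘ P`, up to
  -- applications of `T`. The factor `S h` compensates for `T v`; the factor `h / k`, fixed by `T ∘
  -- P ∘ P`, adjusts only the equation for `T z`.
  refine ⟨hSSq, (h / k) * S h / (S (S b) * w * S μ), 
    div_ne_zero (mul_ne_zero (div_ne_zero hh hk) hSh) (mul_ne_zero (mul_ne_zero hSSb hw0) hSμ), ?_, ?_⟩
  · have hTSb := T0 hSSb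
    have hTw0 := T0 hw0
    rw [hSSq, hTq]
    simp only [map_mul, map_div₀, Sε, Sη, hTh, hTk, hTSh]
    rw [hTS μ, hTμ]
    field_simp
    refine mul_left_cancel₀ (mul_ne_zero hSSk hSSSh) ?_
    linear_combination ε * S (S b) * w * S (S (S h)) * R +
      h * η ^ 2 * θ * (S k * S (S k) * T (S (S b))) * hTw + h * η ^ 2 * θ * ε * w * e4 -
      h * S (S h) * S (S b) * w * S (S (S h)) * ε * ε * η * (θ * θ * hη2 + hθ2)
  · have hPPz : P (P (h / k * S h / (S (S b) * w * S μ))) =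
        P (P (h / k)) * P h / (b * v * P μ) := by
      simp only [map_mul, map_div₀, hPS, hPPw]
    have hTv0 := T0 hv0
    rw [hPPz, map_div₀, map_mul, hPPq, map_mul, map_mul, hTPh, hTP μ, hTμ]
    field_simp
    linear_combination m * T b * hTv + ε * G

end Core

/-! ### Plane equivalence of the normal forms -/

section Families

variable {K : Type*} [Field K]

/-- The graphs of `ψ` and `φ` are related by an invertible matrix with rows `(a, b)`, `(c, d)`. -/
def PlaneEquiv (ψ φ : K → K) : Prop :=
  ∃ a b c d : K, a * d - b * c ≠ 0 ∧ ∀ x, φ (a * x + b * ψ x) = c * x + d * ψ x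

theorem PlaneEquiv.rescale {ψ φ φ' : K → K} (H : PlaneEquiv ψ φ) {r e : K} (hr : r ≠ 0)
    (he : e ≠ 0) (h : ∀ x, φ x = r * φ' (e * x)) : PlaneEquiv ψ φ' := by
  obtain ⟨a, b, c, d, hdet, H⟩ := H
  refine ⟨e * a, e * b, r⁻¹ * c, r⁻¹ * d, ?_, fun x => ?_⟩
  · have : e * a * (r⁻¹ * d) - e * b * (r⁻¹ * c) = e * r⁻¹ * (a * d - b * c) := by ring
    rw [this]
    exact mul_ne_zero (mul_ne_zero he (inv_ne_zero hr)) hdet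
  · have h1 := H x
    rw [h] at h1
    have h2 : e * a * x + e * b * ψ x = e * (a * x + b * ψ x) := by ring
    have h3 : r⁻¹ * c * x + r⁻¹ * d * ψ x = r⁻¹ * (c * x + d * ψ x) := by ring
    rw [h2, h3, ← h1, inv_mul_cancel_left₀ hr]

theorem GLEquiv.planeEquiv {f g : K[X]} (H : GLEquiv f g) :
    PlaneEquiv (fun x => f.eval x) (fun x => g.eval x) := by
  obtain ⟨A, hA⟩ := H
  refine ⟨A.1 0 0, A.1 0 1, A.1 1 0, A.1 1 1, ?_, fun x => ?_⟩
  · rw [← Matrix.det_fin_two]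
    exact ((Matrix.isUnit_iff_isUnit_det _).mp A.isUnit).ne_zero
  · have h1 : (A.1).mulVec ![x, f.eval x] ∈ graphSet g := by
      rw [← hA]
      exact ⟨_, ⟨x, rfl⟩, rfl⟩
    obtain ⟨y, hy⟩ := h1
    have h0 := congrFun hy 0
    have h1 := congrFun hy 1
    simp [Matrix.mulVec, dotProduct, Fin.sum_univ_two] at h0 h1
    change eval _ g = _
    rw [← h0, h1]

theorem pairTerm_add_pairTerm (F : RingAut K) (t : ℕ) (u v u' v' : K) (e : ℤ) (x : K) :
    pairTerm F t u v e x + pairTerm F t u' v' e x = pairTerm F t (u + u') (v + v') e x := by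
  simp only [pairTerm]; ring

/-- The common normal form: `θ = 1` is `ψ` itself, and `θ = -1` arises when `ℓ` is shifted by `t`.
-/
theorem family_equiv (F : RingAut K) {t : ℕ} (ht : 5 ≤ t) (hF : orderOf F = 2 * t)
    {m h μ k ε η θ : K}
    (hε : ε = 1 ∨ ε = -1) (hη : η = 1 ∨ η = -1) (hθ : θ = 1 ∨ θ = -1)
    (hh : h ≠ 0) (hk : k ≠ 0) (hm : m ≠ 0) (hμ : μ ≠ 0)
    (hTh : (F ^ (t : ℤ)) h = ε / h) (hTk : (F ^ (t : ℤ)) k = η / k)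
    (hTm : (F ^ (t : ℤ)) m = m) (hTμ : (F ^ (t : ℤ)) μ = μ)
    (hκ : 1 + ε * (h * F (F h)) ≠ 0) {φ ψ : K → K}
    (hψ : ∀ x, ψ x = pairTerm F t m (-(m * ε * h * F h)) 1 x
      + pairTerm F t (h / F⁻¹ h) 1 (-1) x)
    (hφ : ∀ x, φ x = pairTerm F t μ (-(μ * θ * η * k * F k)) 1 x
      + pairTerm F t (θ * (k / F⁻¹ k)) 1 (-1) x)
    (H : PlaneEquiv ψ φ) :
    F (F (h / k)) = (F ^ (t : ℤ)) (h / k) ∧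
      ((∃ z : K, z ≠ 0 ∧ (F ^ (t : ℤ)) z = -θ * (F (F (F (h / k))) / (h / k)) * z ∧
        m / F⁻¹ μ = -((F ^ (t : ℤ)) (F⁻¹ (F⁻¹ z)) / z)) ∨
      (∃ z : K, z ≠ 0 ∧ (F ^ (t : ℤ)) z = θ * (F (F (F (h / k))) / (h / k)) * z ∧
        m / μ = (F ^ (t : ℤ)) (F⁻¹ (F⁻¹ z)) / z)) := by
  obtain ⟨a, b, c, d, hdet, H⟩ := H
  have hT1 : F ^ (t : ℤ) ≠ 1 := by
    intro h1
    rw [zpow_natCast] at h1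
    have h2 := orderOf_dvd_of_pow_eq_one h1
    rw [hF] at h2
    have := Nat.le_of_dvd (by omega) h2
    omega
  -- Differences of classes between `-2` and `2` have absolute value at most `4`; this is where `t ≥
  -- 5` is needed.
  have hnd : ∀ j : ℤ, j ≠ 0 → |j| < 5 → ¬ (t : ℤ) ∣ j := by
    intro j hj hj5 hdvd
    have := Int.le_of_dvd (abs_pos.mpr hj) ((dvd_abs _ _).mpr hdvd)
    omega
  have p1 := hnd 1 (by norm_num) (by norm_num)
  have p2 := hnd 2 (by norm_num) (by norm_num)
  have p3 := hnd 3 (by norm_num) (by norm_num)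
  have p4 := hnd 4 (by norm_num) (by norm_num)
  have q1 := hnd (-1) (by norm_num) (by norm_num)
  have q2 := hnd (-2) (by norm_num) (by norm_num)
  have q3 := hnd (-3) (by norm_num) (by norm_num)
  have q4 := hnd (-4) (by norm_num) (by norm_num)
  have key := class_separation F hF 1 1 _ _ _ _ _ _ _ _ a b c d φ ψ hψ hφ H
  have c2 := key 2
  have cm2 := key (-2)
  have c1 := key 1
  have cm1 := key (-1)
  have c0 := key 0
  simp only [Int.reduceSub, Int.reduceAdd, Int.reduceNeg, p1, p2, p3, p4, q1, q2, q3, q4,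
    dvd_zero, if_true, if_false, zero_add, add_zero, pairTerm_add_pairTerm] at c2 cm2 c1 cm1 c0
  have c2 := (pairTerm_eq_zero hT1 c2).1
  have cm2 := (pairTerm_eq_zero hT1 cm2).2
  have c1 := pairTerm_eq_zero hT1 c1
  have cm1 := pairTerm_eq_zero hT1 cm1
  have c0 := pairTerm_eq_zero hT1 c0
  simp only [zpow_one, zpow_neg_one] at c2 cm2 c1 cm1 c0
  let S : K →+* K := RingEquiv.toRingHom F
  let P : K →+* K := RingEquiv.toRingHom F⁻¹
  let T : K →+* K := RingEquiv.toRingHom (F ^ (t : ℤ))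
  have hSP : ∀ x, S (P x) = x := fun x => by
    change (F * F⁻¹) x = x
    rw [mul_inv_cancel, RingAut.one_apply]
  have hPS : ∀ x, P (S x) = x := fun x => by
    change (F⁻¹ * F) x = x
    rw [inv_mul_cancel, RingAut.one_apply]
  have hTS : ∀ x, T (S x) = S (T x) := fun x => by
    change (F ^ (t : ℤ) * F) x = (F * F ^ (t : ℤ)) x
    rw [← zpow_add_one, ← zpow_one_add, add_comm]
  by_cases hb : b = 0
  · have hc : c = 0 := by simpa [hb] using c0.1
    have ha : a ≠ 0 := by
      rintro rfl
      simp [hb] at hdet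
    have := diagonal_case S P T hSP hPS hTS hε hη hθ hh hk hμ hTh hTk ha
      (add_neg_eq_zero.mp c1.1) (add_neg_eq_zero.mp c1.2)
      (add_neg_eq_zero.mp cm1.1) (by
        have h4 := add_neg_eq_zero.mp cm1.2
        rwa [one_mul, mul_one] at h4)
    exact ⟨this.1, Or.inr this.2⟩
  · have := antidiagonal_case S P T hSP hPS hTS hε hη hθ hh hk hm hμ hTh hTk hTm hTμ hκ hb
      c2 cm2 c0.2
    exact ⟨this.1, Or.inl this.2⟩

/-- Refolds an expanded product from `class_separation` into a composition, so that it visibly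
vanishes where the inner part does. -/
theorem pairTerm_pairTerm (F : RingAut K) {t : ℕ} (hF : orderOf F = 2 * t)
    (A₀ A₁ b β₀ β₁ : K) (l e : ℤ) (x : K) :
    pairTerm F t (A₀ * (F ^ l) (b * β₀) + A₁ * (F ^ (t : ℤ)) ((F ^ l) (b * β₁)))
      (A₀ * (F ^ l) (b * β₁) + A₁ * (F ^ (t : ℤ)) ((F ^ l) (b * β₀))) (l + e) x =
      pairTerm F t A₀ A₁ l (b * pairTerm F t β₀ β₁ e x) := by
  have hTT : ∀ y, (F ^ (t : ℤ)) ((F ^ (t : ℤ)) y) = y := by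
    intro y
    rw [← RingAut.mul_apply, ← zpow_add]
    have : F ^ ((t : ℤ) + t) = 1 := by
      apply orderOf_dvd_iff_zpow_eq_one.mp
      rw [hF]; push_cast; rw [two_mul]
    rw [this, RingAut.one_apply]
  have hcomm : ∀ (e : ℤ) y, (F ^ e) ((F ^ (t : ℤ)) y) = (F ^ (t : ℤ)) ((F ^ e) y) := by
    intro e y
    rw [← RingAut.mul_apply, ← RingAut.mul_apply, ← zpow_add, ← zpow_add, add_comm]
  simp only [pairTerm, zpow_add F l e, RingAut.mul_apply, map_add, map_mul, hcomm, hTT]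
  ring

theorem not_planeEquiv (F : RingAut K) {t : ℕ} (hF : orderOf F = 2 * t) (ht : 0 < t)
    {s l : ℤ} {h m ε μ A₁ B₀ B₁ : K}
    (hh : h ≠ 0) (hm : m ≠ 0) (hε : ε = 1 ∨ ε = -1)
    (hTh : (F ^ (t : ℤ)) h = ε / h)
    (hκ : 1 + ε * (h * (F ^ s) ((F ^ s) h)) ≠ 0) {φ ψ : K → K}
    (hψ : ∀ x, ψ x = pairTerm F t m (-(m * ε * h * (F ^ s) h)) s x
      + pairTerm F t (h / (F ^ (-s)) h) 1 (-s) x)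
    (hφ : ∀ x, φ x = pairTerm F t μ A₁ l x + pairTerm F t B₀ B₁ (-l) x)
    (hs : ¬ (t : ℤ) ∣ s) (h2s : ¬ (t : ℤ) ∣ 2 * s) (hl : ¬ (t : ℤ) ∣ l)
    (hls : ¬ (t : ℤ) ∣ l - s) (hls' : ¬ (t : ℤ) ∣ l + s) : ¬ PlaneEquiv ψ φ := by
  rintro ⟨a, b, c, d, hdet, H⟩
  have hT1 : F ^ (t : ℤ) ≠ 1 := by
    intro h1
    rw [zpow_natCast] at h1
    have h2 := orderOf_dvd_of_pow_eq_one h1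
    rw [hF] at h2
    have := Nat.le_of_dvd ht h2
    omega
  have hTT : ∀ y, (F ^ (t : ℤ)) ((F ^ (t : ℤ)) y) = y := by
    intro y
    rw [← RingAut.mul_apply, ← zpow_add]
    have : F ^ ((t : ℤ) + t) = 1 := by
      apply orderOf_dvd_iff_zpow_eq_one.mp
      rw [hF]; push_cast; rw [two_mul]
    rw [this, RingAut.one_apply]
  have hcomm : ∀ (e f : ℤ) y, (F ^ e) ((F ^ f) y) = (F ^ f) ((F ^ e) y) := by
    intro e f y
    rw [← RingAut.mul_apply, ← RingAut.mul_apply, ← zpow_add, ← zpow_add, add_comm]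
  have hinv : ∀ (e : ℤ) y, (F ^ (-e)) ((F ^ e) y) = y := by
    intro e y
    rw [← RingAut.mul_apply, ← zpow_add, neg_add_cancel, zpow_zero, RingAut.one_apply]
  have hF0 : ∀ (e : ℤ) {y : K}, y ≠ 0 → (F ^ e) y ≠ 0 := fun e y hy =>
    (map_ne_zero (F ^ e)).mpr hy
  have hε2 : ε * ε = 1 := by rcases hε with rfl | rfl <;> ring
  have hε0 : ε ≠ 0 := left_ne_zero_of_mul_eq_one hε2
  have Fε : ∀ e : ℤ, (F ^ e) ε = ε := by
    intro e; rcases hε with rfl | rfl <;> simp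
  have key := class_separation F hF s l _ _ _ _ _ _ _ _ a b c d φ ψ hψ hφ H
  have n1 : ¬ (t : ℤ) ∣ -l := by rwa [dvd_neg]
  have n2 : ¬ (t : ℤ) ∣ -s := by rwa [dvd_neg]
  have n3 : ¬ (t : ℤ) ∣ -l + s := by rwa [← dvd_neg, show -(-l + s) = l - s by ring]
  have n4 : ¬ (t : ℤ) ∣ -l - s := by rwa [← dvd_neg, show -(-l - s) = l + s by ring]
  have hc : c = 0 := by
    have c0 := key 0
    simp only [sub_zero, hs, hls, hls', hl, n1, n2, n3, n4, dvd_zero, if_true, if_false,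
      zero_add, add_zero] at c0
    simpa using (pairTerm_eq_zero hT1 c0).1
  have hd : d ≠ 0 := by
    rintro rfl
    simp [hc] at hdet
  -- Class `s` may also contain `l - s` or `-l - s`, when `l ≡ ±2s`. Both terms are compositions
  -- with the `-s` part of `ψ`, so they disappear on its kernel.
  have hker : ∀ x, pairTerm F t (h / (F ^ (-s)) h) 1 (-s) x = 0 →
      pairTerm F t m (-(m * ε * h * (F ^ s) h)) s x = 0 := by
    intro x hx
    have e1 := pairTerm_pairTerm F hF μ A₁ b (h / (F ^ (-s)) h) 1 l (-s) x
    have e2 := pairTerm_pairTerm F hF B₀ B₁ b (h / (F ^ (-s)) h) 1 (-l) (-s) x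
    rw [hx, mul_zero, ← sub_eq_add_neg] at e1 e2
    have hz : ∀ (u v : K) (e : ℤ), pairTerm F t u v e 0 = 0 := fun u v e => by simp [pairTerm]
    rw [hz] at e1 e2
    have c1 := key s x
    have n5 : ¬ (t : ℤ) ∣ -s - s := by rwa [← dvd_neg, show -(-s - s) = 2 * s by ring]
    rw [e1, e2] at c1
    simp only [hls, n4, n5, add_sub_cancel_right, hl, n1, zero_sub, n2, sub_self, dvd_zero,
      if_true, if_false, ite_self, zero_add, add_zero] at c1
    have h5 : -d * pairTerm F t m (-(m * ε * h * (F ^ s) h)) s x = 0 := by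
      rw [← c1]
      simp only [pairTerm]; ring
    exact (mul_eq_zero.mp h5).resolve_left (neg_ne_zero.mpr hd)
  have hPh := hF0 (-s) hh
  have hSh := hF0 s hh
  have hSSh := hF0 s hSh
  have hTPh : (F ^ (t : ℤ)) ((F ^ (-s)) h) = ε / (F ^ (-s)) h := by
    rw [hcomm, hTh, map_div₀, Fε]
  have hTSh : (F ^ (t : ℤ)) ((F ^ s) h) = ε / (F ^ s) h := by
    rw [hcomm, hTh, map_div₀, Fε]
  have hTSSh : (F ^ (t : ℤ)) ((F ^ s) ((F ^ s) h)) = ε / (F ^ s) ((F ^ s) h) := by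
    rw [hcomm, hTSh, map_div₀, Fε]
  have hall : ∀ w, pairTerm F t (m * (1 + ε * (h * (F ^ s) ((F ^ s) h))))
      (-(m * (1 + ε * (h * (F ^ s) ((F ^ s) h))) * ((F ^ s) h / (F ^ s) ((F ^ s) h))))
      (s + s) w = 0 := by
    intro w
    -- These arguments lie in the kernel of the `-s` part because `T` inverts `(F ^ (-s)) h / h`.
    have h1 := hker ((F ^ s) (w - (F ^ (-s)) h / h * (F ^ (t : ℤ)) w)) (by
      simp only [pairTerm, hinv, map_sub, map_mul, map_div₀, hTT, hTh, hTPh]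
      field_simp
      ring)
    have hSP : (F ^ s) ((F ^ (-s)) h) = h := by
      have := hinv (-s) h
      rwa [neg_neg] at this
    rw [← h1]
    simp only [pairTerm, zpow_add, RingAut.mul_apply, map_sub, map_mul, map_div₀, hSP,
      hcomm s t, hTT, hTSh, hTSSh]
    field_simp
    ring
  exact mul_ne_zero hm hκ (pairTerm_eq_zero hT1 hall).1

end Families

/-! ### Frobenius, the shape of `ψ`, and the norm conditions -/

section Frobenius

variable {K : Type*} [Field K]

theorem exists_frobenius [Finite K] {q t : ℕ} (hq : IsPrimePow q) (ht : 0 < t)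
    (hK : Nat.card K = q ^ (2 * t)) :
    ∃ F : RingAut K, (∀ x, F x = x ^ q) ∧ orderOf F = 2 * t := by
  classical
  have := Fintype.ofFinite K
  obtain ⟨p, r, hp, hr, rfl⟩ := hq
  have hp' : p.Prime := hp.nat_prime
  have : Fact p.Prime := ⟨hp'⟩
  have hcard : Fintype.card K = (p ^ r) ^ (2 * t) := by rw [← Nat.card_eq_fintype_card, hK]
  have : CharP K p := by
    obtain ⟨p', hchar⟩ := CharP.exists K
    obtain ⟨n, hp'', hn⟩ := FiniteField.card K p'
    have h1 : p' ∣ p ^ (r * (2 * t)) := by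
      rw [pow_mul, ← hcard, hn]
      exact dvd_pow_self _ n.pos.ne'
    have h2 := (Nat.prime_dvd_prime_iff_eq hp'' hp').mp (hp''.dvd_of_dvd_pow h1)
    exact h2 ▸ hchar
  have hinj : Function.Injective (iterateFrobenius K p r) := (iterateFrobenius K p r).injective
  let F : RingAut K := RingEquiv.ofBijective (iterateFrobenius K p r)
    (Finite.injective_iff_bijective.mp hinj)
  have hF : ∀ x, F x = x ^ p ^ r := fun x => iterateFrobenius_def p r x
  have hFn : ∀ (n : ℕ) x, (F ^ n) x = x ^ (p ^ r) ^ n := by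
    intro n
    induction n with
    | zero => intro x; simp
    | succ n ih => intro x; rw [pow_succ', RingAut.mul_apply, hF, ih, ← pow_mul, ← pow_succ]
  refine ⟨F, hF, ?_⟩
  have h2t : 0 < 2 * t := by omega
  refine (orderOf_eq_iff h2t).mpr ⟨?_, ?_⟩
  · ext x
    rw [hFn, ← hcard, FiniteField.pow_card, RingAut.one_apply]
  · intro j hj hj0 h1
    have hq1 : 1 < p ^ r := Nat.one_lt_pow hr.ne' hp'.one_lt
    have hqj : 1 < (p ^ r) ^ j := Nat.one_lt_pow hj0.ne' hq1
    have hroots : ∀ x : K, x ∈ (X ^ ((p ^ r) ^ j) - X : K[X]).roots := by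
      intro x
      rw [mem_roots (FiniteField.X_pow_card_sub_X_ne_zero K hqj)]
      have := hFn j x
      rw [h1, RingAut.one_apply] at this
      simp [← this]
    have h3 : Fintype.card K ≤ (p ^ r) ^ j := by
      have h4 : (Finset.univ : Finset K) ⊆ (X ^ ((p ^ r) ^ j) - X : K[X]).roots.toFinset :=
        fun x _ => Multiset.mem_toFinset.mpr (hroots x)
      calc Fintype.card K ≤ _ := Finset.card_le_card h4
        _ ≤ _ := Multiset.toFinset_card_le _
        _ ≤ _ := card_roots' _
        _ = _ := FiniteField.X_pow_card_sub_X_natDegree_eq K hqj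
    rw [hcard] at h3
    exact absurd h3 (not_le.mpr (Nat.pow_lt_pow_right hq1 hj))

theorem pow_eq_zpow_apply {q N : ℕ} {F : RingAut K} (hF : ∀ x, F x = x ^ q)
    (hord : orderOf F = N) {n : ℕ} {e : ℤ} (h : (N : ℤ) ∣ n - e) (x : K) :
    x ^ q ^ n = (F ^ e) x := by
  have hFn : ∀ (n : ℕ) x, (F ^ n) x = x ^ q ^ n := by
    intro n
    induction n with
    | zero => intro x; simp
    | succ n ih => intro x; rw [pow_succ', RingAut.mul_apply, hF, ih, ← pow_mul, ← pow_succ]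
  have h1 : F ^ (n : ℤ) = F ^ e := by
    rw [← mul_inv_eq_one, ← zpow_sub]
    exact orderOf_dvd_iff_zpow_eq_one.mp (hord ▸ h)
  rw [← hFn, ← h1, zpow_natCast]

theorem pow_sub_one_eq_div {x : K} (hx : x ≠ 0) {q n : ℕ} (hq : 0 < q) :
    x ^ (q ^ n - 1) = x ^ q ^ n / x := by
  rw [eq_div_iff hx, ← pow_succ, Nat.sub_add_cancel (Nat.one_le_pow _ _ hq)]

/-- Oddness of `s` gives `s t ≡ t` modulo `2t`, so the exponents are `s`, `t + s`, `t - s`, `-s`;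
the norm condition turns `h / T (S h)` into `ε h S(h)`. -/
theorem psi_eval {q t s : ℕ} {F : RingAut K} (hF : ∀ x, F x = x ^ q)
    (hord : orderOf F = 2 * t) (ht : 0 < t) (hs : Odd s) {m h ε : K} (hh : h ≠ 0)
    (hε : ε = 1 ∨ ε = -1) (hTh : (F ^ (t : ℤ)) h = ε / h) (x : K) :
    (psi q t m h s).eval x = pairTerm F t m (-(m * ε * h * (F ^ (s : ℤ)) h)) s x
      + pairTerm F t (h / (F ^ (-(s : ℤ))) h) 1 (-s) x := by
  obtain ⟨r, hr⟩ := hs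
  have h1 : ∀ y : K, y ^ q ^ s = (F ^ (s : ℤ)) y :=
    pow_eq_zpow_apply hF hord (by simp)
  have h2 : ∀ y : K, y ^ q ^ (s * (t + 1)) = (F ^ (t : ℤ)) ((F ^ (s : ℤ)) y) := fun y => by
    rw [← RingAut.mul_apply, ← zpow_add]
    refine pow_eq_zpow_apply hF hord ⟨r, ?_⟩ y
    rw [hr]; push_cast; ring
  have h3 : ∀ y : K, y ^ q ^ (s * (t - 1)) = (F ^ (t : ℤ)) ((F ^ (-(s : ℤ))) y) := fun y => by
    rw [← RingAut.mul_apply, ← zpow_add]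
    refine pow_eq_zpow_apply hF hord ⟨r, ?_⟩ y
    rw [hr]; push_cast [Nat.cast_sub (show 1 ≤ t from ht)]; ring
  have h4 : ∀ y : K, y ^ q ^ (s * (2 * t - 1)) = (F ^ (-(s : ℤ))) y := fun y => by
    refine pow_eq_zpow_apply hF hord ⟨s, ?_⟩ y
    rw [hr]; push_cast [Nat.cast_sub (show 1 ≤ 2 * t by omega)]; ring
  have h5 : ∀ n : ℕ, h ^ (1 - (q : ℤ) ^ n) = h / h ^ q ^ n := fun n => by
    rw [zpow_sub₀ hh, zpow_one]
    norm_cast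
  have hε2 : ε * ε = 1 := by rcases hε with rfl | rfl <;> ring
  have hε0 : ε ≠ 0 := left_ne_zero_of_mul_eq_one hε2
  have hTSh : (F ^ (t : ℤ)) ((F ^ (s : ℤ)) h) = ε / (F ^ (s : ℤ)) h := by
    have : (F ^ (t : ℤ)) ((F ^ (s : ℤ)) h) = (F ^ (s : ℤ)) ((F ^ (t : ℤ)) h) := by
      rw [← RingAut.mul_apply, ← RingAut.mul_apply, ← zpow_add, ← zpow_add, add_comm]
    rw [this, hTh, map_div₀]
    rcases hε with rfl | rfl <;> simp
  have hSh : (F ^ (s : ℤ)) h ≠ 0 := (map_ne_zero (F ^ (s : ℤ))).mpr hh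
  have h6 : h / (ε / (F ^ (s : ℤ)) h) = ε * h * (F ^ (s : ℤ)) h := by
    field_simp
    linear_combination -hε2
  simp only [psi, eval_add, eval_mul, eval_sub, eval_C, eval_pow, eval_X, h5, h1, h2, h3, h4,
    hTSh, h6, pairTerm]
  ring

theorem nm_eq {q t : ℕ} (hq : 1 < q) (ht : 0 < t) (x : K) :
    nm q (2 * t) t x = x * x ^ q ^ t := by
  have h1 : 1 < q ^ t := Nat.one_lt_pow ht.ne' hq
  have h2 : (q ^ (2 * t) - 1) / (q ^ t - 1) = q ^ t + 1 := by
    apply Nat.div_eq_of_eq_mul_left (by omega)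
    zify [h1.le, Nat.one_le_pow (2 * t) q (by omega)]
    ring
  rw [nm, h2, pow_succ']

theorem Admissible.norm {q t s : ℕ} {m h : K} (hq : 1 < q) (ht : 0 < t)
    (H : Admissible q t m h s) :
    ∃ ε : K, (ε = 1 ∨ ε = -1) ∧ h ≠ 0 ∧ h ^ q ^ t = ε / h ∧
      (Odd t → q % 4 = 3 → h ^ 2 = -1 → ε = -1) := by
  have key : ∃ ε : K, (ε = 1 ∨ ε = -1) ∧ nm q (2 * t) t h = ε ∧
      (Odd t → q % 4 = 3 → h ^ 2 = -1 → ε = -1) := by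
    rcases H.2.2 with ⟨hc, -, hn⟩ | ⟨-, ⟨-, hn⟩ | ⟨-, hn, h2⟩⟩
    · refine ⟨_, hn, rfl, fun ho h3 => ?_⟩
      rcases hc with he | ⟨-, h1⟩
      · exact absurd he (Nat.not_even_iff_odd.mpr ho)
      · omega
    · exact ⟨-1, Or.inr rfl, hn, fun _ _ _ => rfl⟩
    · exact ⟨1, Or.inl rfl, hn, fun _ _ h => absurd h h2⟩
  obtain ⟨ε, hε, hn, h2⟩ := key
  rw [nm_eq hq ht] at hn
  have hε0 : ε ≠ 0 := by rcases hε with rfl | rfl <;> simp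
  have hh : h ≠ 0 := left_ne_zero_of_mul (hn ▸ hε0)
  exact ⟨ε, hε, hh, by rw [eq_div_iff hh, ← hn, mul_comm], h2⟩

theorem two_ne_zero_of_odd_card [Finite K] (hK : Odd (Nat.card K)) : (2 : K) ≠ 0 := by
  have := Fintype.ofFinite K
  intro h2
  have : CharP K 2 := CharTwo.of_one_ne_zero_of_two_eq_zero one_ne_zero h2
  have h3 : ringChar K = 2 := ringChar.eq K 2 ▸ rfl
  have := FiniteField.even_card_of_char_two h3
  rw [Nat.card_eq_fintype_card, Nat.odd_iff] at hK
  omega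

/-- Vanishing would give `G (G h) = -ε / h` for `G = F ^ s`, hence `G^4 h = h`. Comparing with `T h
= G^t h = ε / h` according to `t` modulo `4` leaves only `t` odd, `ε = 1`, `h² = -1`, `G h = -h`.
The case `q ≡ 3` modulo `4` is then excluded by `hexc`; if `q ≡ 1`, Frobenius fixes the fourth root
of unity `h`. -/
theorem one_add_mul_ne_zero {q t s : ℕ} {F : RingAut K} (hF : ∀ x, F x = x ^ q)
    (hord : orderOf F = 2 * t) (hs : Odd s) (hq : Odd q) (h2 : (2 : K) ≠ 0) {h ε : K}
    (hh : h ≠ 0) (hε : ε = 1 ∨ ε = -1) (hTh : (F ^ (t : ℤ)) h = ε / h)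
    (hexc : Odd t → q % 4 = 3 → h ^ 2 = -1 → ε = -1) :
    1 + ε * (h * (F ^ (s : ℤ)) ((F ^ (s : ℤ)) h)) ≠ 0 := by
  intro h0
  have hε2 : ε * ε = 1 := by rcases hε with rfl | rfl <;> ring
  have hε0 : ε ≠ 0 := left_ne_zero_of_mul_eq_one hε2
  obtain ⟨G, hG⟩ : ∃ G, G = F ^ (s : ℤ) := ⟨_, rfl⟩
  rw [← hG] at h0
  have hGε : G ε = ε := by rcases hε with rfl | rfl <;> simp
  have hGt : G ^ t = F ^ (t : ℤ) := by
    rw [hG, ← zpow_natCast, ← zpow_mul, ← mul_inv_eq_one, ← zpow_sub]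
    apply orderOf_dvd_iff_zpow_eq_one.mp
    obtain ⟨r, hr⟩ := hs
    rw [hord, hr]
    exact ⟨r, by push_cast; ring⟩
  have hG2t : G ^ (2 * t) = 1 := by
    rw [two_mul, pow_add, hGt, ← zpow_add]
    apply orderOf_dvd_iff_zpow_eq_one.mp
    rw [hord]; push_cast; rw [two_mul]
  have hGh : G h = h ^ q ^ s := by
    rw [hG]; exact (pow_eq_zpow_apply hF hord (by simp) h).symm
  have hGG : G (G h) = -ε / h := by
    field_simp
    linear_combination ε * h0 - h * G (G h) * hε2
  have hG4 : (G ^ 4) h = h := by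
    have h1 : (G ^ 4) h = G (G (G (G h))) := by
      simp only [pow_succ, pow_zero, one_mul, RingAut.mul_apply]
    rw [h1, hGG, map_div₀, map_div₀, hGG, map_neg, map_neg, hGε, hGε]
    field_simp
  have hred : ∀ j r : ℕ, (G ^ (4 * j + r)) h = (G ^ r) h := by
    intro j
    induction j with
    | zero => intro r; simp
    | succ j ih =>
      intro r
      rw [show 4 * (j + 1) + r = (4 * j + r) + 4 by ring, pow_add, RingAut.mul_apply, hG4, ih]
  have hne : h ≠ -h := fun hc => hh (by
    have : 2 * h = 0 := by linear_combination hc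
    exact (mul_eq_zero.mp this).resolve_left h2)
  rw [← hGt] at hTh
  rcases Nat.even_or_odd t with he | ho
  · have h4 : t = 4 * (t / 4) ∨ t = 4 * (t / 4) + 2 := by
      obtain ⟨r, hr⟩ := he; omega
    rcases h4 with h4 | h4
    · have h5 := hred (t / 4) 0
      rw [add_zero, ← h4, pow_zero, RingAut.one_apply, hTh] at h5
      have hsq : h * h = ε := by
        field_simp at h5
        linear_combination -h5
      have h6 : G h = h ∨ G h = -h := by
        apply mul_self_eq_mul_self_iff.mp
        rw [← map_mul, hsq, hGε]
      have h7 : G (G h) = h := by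
        rcases h6 with h6 | h6
        · rw [h6, h6]
        · rw [h6, map_neg, h6, neg_neg]
      apply hne
      rw [hGG, neg_div, h5] at h7
      exact h7.symm
    · have h5 := hred (t / 4) 2
      rw [← h4, hTh, pow_two, RingAut.mul_apply, hGG] at h5
      field_simp at h5
      exact h2 (by linear_combination h5)
  · have hGGh : G (G h) = h := by
      have h4 : 2 * t = 4 * (2 * t / 4) + 2 := by
        obtain ⟨r, hr⟩ := ho; omega
      have h5 := hred (2 * t / 4) 2
      rwa [← h4, hG2t, RingAut.one_apply, pow_two, RingAut.mul_apply, eq_comm] at h5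
    have hsq : h * h = -ε := by
      rw [hGG] at hGGh
      field_simp at hGGh
      linear_combination -hGGh
    have hGh' : G h = -h := by
      have h6 : G h = ε / h := by
        rw [← hTh]
        have h4 : t = 4 * (t / 4) + 1 ∨ t = 4 * (t / 4) + 3 := by
          obtain ⟨r, hr⟩ := ho; omega
        rcases h4 with h4 | h4
        · rw [h4, hred, pow_one]
        · rw [h4, hred]
          simp only [pow_succ, pow_zero, one_mul, RingAut.mul_apply, hGGh]
      rw [h6]
      field_simp
      linear_combination hsq
    rcases hε with rfl | rfl
    · have h3 : q % 4 = 1 := by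
        obtain ⟨r, hr⟩ := hq
        have : ¬ q % 4 = 3 := fun h3 => by
          have := hexc ho h3 (by rw [pow_two, hsq])
          exact h2 (by linear_combination this)
        omega
      have h4 : q ^ s % 4 = 1 := by
        have : q ^ s ≡ 1 ^ s [MOD 4] := Nat.ModEq.pow s h3
        simpa [Nat.ModEq] using this
      have h5 : h ^ 4 = 1 := by linear_combination (h * h - 1) * hsq
      apply hne
      rw [← hGh', hGh, ← Nat.div_add_mod (q ^ s) 4, h4, pow_add, pow_mul, h5, one_pow, one_mul,
        pow_one]
    · have h5 : h = 1 ∨ h = -1 := by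
        apply mul_self_eq_mul_self_iff.mp
        rw [hsq]; ring
      apply hne
      rw [← hGh']
      rcases h5 with rfl | rfl <;> simp

/-- The stabilizer of `x` contains `F^(s(t-2))`. As `s` is invertible modulo `2t`, Bézout puts
`F^gcd(t-2, 2t)` in it too. -/
theorem mem_subF_of_fixed {q t s : ℕ} {F : RingAut K} (hF : ∀ x, F x = x ^ q)
    (hord : orderOf F = 2 * t) (hs : Nat.gcd s (2 * t) = 1) (ht : 2 ≤ t) {x : K}
    (hodd : Odd s) (hx : (F ^ (s : ℤ)) ((F ^ (s : ℤ)) x) = (F ^ (t : ℤ)) x) :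
    x ∈ subF K q (Nat.gcd (t - 2) (2 * t)) := by
  have h0 : F ^ (t : ℤ) = F ^ (t * s : ℤ) := by
    rw [← mul_inv_eq_one, ← zpow_sub]
    apply orderOf_dvd_iff_zpow_eq_one.mp
    obtain ⟨r, hr⟩ := hodd
    rw [hord, hr]
    exact ⟨-r, by push_cast; ring⟩
  rw [h0] at hx
  have h1 : F ^ ((s : ℤ) * (t - 2)) ∈ MulAction.stabilizer (RingAut K) x := by
    rw [MulAction.mem_stabilizer_iff, RingAut.smul_def,
      show (s : ℤ) * (t - 2) = -(s + s) + t * s by ring, zpow_add, RingAut.mul_apply, ← hx,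
      ← RingAut.mul_apply, ← RingAut.mul_apply, ← zpow_add, ← zpow_add]
    simp
  have h2 : F ^ (2 * t : ℤ) = 1 := by
    apply orderOf_dvd_iff_zpow_eq_one.mp
    rw [hord]; push_cast; exact dvd_refl _
  have h3 := Nat.gcd_eq_gcd_ab (t - 2) (2 * t)
  have h4 := Nat.gcd_eq_gcd_ab s (2 * t)
  rw [hs] at h4
  set a := Nat.gcdA (t - 2) (2 * t)
  set b := Nat.gcdB (t - 2) (2 * t)
  set u := Nat.gcdA s (2 * t)
  set v := Nat.gcdB s (2 * t)
  push_cast [Nat.cast_sub ht] at h3 h4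
  have h5 : ((Nat.gcd (t - 2) (2 * t) : ℕ) : ℤ) =
      (s * (t - 2)) * (u * a) + (2 * t) * (v * a * (t - 2) + b) := by
    rw [h3]
    linear_combination (t - 2) * a * h4
  have h6 : F ^ ((Nat.gcd (t - 2) (2 * t) : ℕ) : ℤ) ∈ MulAction.stabilizer (RingAut K) x := by
    rw [h5, zpow_add, zpow_mul, zpow_mul F (2 * t), h2, one_zpow, mul_one]
    exact Subgroup.zpow_mem _ h1 _
  rw [MulAction.mem_stabilizer_iff, RingAut.smul_def] at h6
  change x ^ q ^ _ = x
  rw [pow_eq_zpow_apply hF hord (e := ((Nat.gcd (t - 2) (2 * t) : ℕ) : ℤ)) (by simp), h6]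

end Frobenius

/-! ### Reversing the two classes, and adjusting the witness -/

section Main

variable {K : Type*} [Field K]

theorem exists_neg_of_ne_one {T : RingAut K} (hT : T ≠ 1) (hTT : ∀ x, T (T x) = x) :
    ∃ ω : K, ω ≠ 0 ∧ T ω = -ω := by
  obtain ⟨y, hy⟩ : ∃ y, T y ≠ y := by
    by_contra! hc
    exact hT (RingEquiv.ext hc)
  refine ⟨y - T y, sub_ne_zero.mpr hy.symm, ?_⟩
  rw [map_sub, hTT, neg_sub]

/-- The roles of classes `1` and `-1` are exchanged. Substituting `x / k` restores the form with
`k⁻¹`, except for the relative sign inside each pair; an `ω` with `T ω = -ω` repairs it. The new `μ`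
is fixed by `T` because it contains a quotient of two elements that `T` negates. -/
theorem family_equiv_inv (F : RingAut K) {t : ℕ} (ht : 5 ≤ t) (hF : orderOf F = 2 * t)
    {m h μ k ε η θ : K}
    (hε : ε = 1 ∨ ε = -1) (hη : η = 1 ∨ η = -1) (hθ : θ = 1 ∨ θ = -1)
    (hh : h ≠ 0) (hk : k ≠ 0) (hm : m ≠ 0) (hμ : μ ≠ 0)
    (hTh : (F ^ (t : ℤ)) h = ε / h) (hTk : (F ^ (t : ℤ)) k = η / k)
    (hTm : (F ^ (t : ℤ)) m = m) (hTμ : (F ^ (t : ℤ)) μ = μ)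
    (hκ : 1 + ε * (h * F (F h)) ≠ 0) {φ ψ : K → K}
    (hψ : ∀ x, ψ x = pairTerm F t m (-(m * ε * h * F h)) 1 x
      + pairTerm F t (h / F⁻¹ h) 1 (-1) x)
    (hφ : ∀ x, φ x = pairTerm F t (θ * (k / F k)) 1 1 x
      + pairTerm F t μ (-(μ * θ * η * k * F⁻¹ k)) (-1) x)
    (H : PlaneEquiv ψ φ) :
    F (F (h * k)) = (F ^ (t : ℤ)) (h * k) ∧
      ((∃ z : K, z ≠ 0 ∧ (F ^ (t : ℤ)) z = θ * (F (F (F (h * k))) / (h * k)) * z ∧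
        m * F⁻¹ μ = (F ^ (t : ℤ)) (F⁻¹ (F⁻¹ z)) / z) ∨
      (∃ z : K, z ≠ 0 ∧ (F ^ (t : ℤ)) z = -θ * (F (F (F (h * k))) / (h * k)) * z ∧
        m * μ = -((F ^ (t : ℤ)) (F⁻¹ (F⁻¹ z)) / z))) := by
  have hT1 : F ^ (t : ℤ) ≠ 1 := by
    intro h1
    rw [zpow_natCast] at h1
    have h2 := orderOf_dvd_of_pow_eq_one h1
    rw [hF] at h2
    have := Nat.le_of_dvd (by omega) h2
    omega
  have hTT : ∀ y, (F ^ (t : ℤ)) ((F ^ (t : ℤ)) y) = y := by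
    intro y
    rw [← RingAut.mul_apply, ← zpow_add]
    have : F ^ ((t : ℤ) + t) = 1 := by
      apply orderOf_dvd_iff_zpow_eq_one.mp
      rw [hF]; push_cast; rw [two_mul]
    rw [this, RingAut.one_apply]
  obtain ⟨ω, hω, hTω⟩ := exists_neg_of_ne_one hT1 hTT
  have hSP : ∀ x, F (F⁻¹ x) = x := fun x => by
    rw [← RingAut.mul_apply, mul_inv_cancel, RingAut.one_apply]
  have hPS : ∀ x, F⁻¹ (F x) = x := fun x => by
    rw [← RingAut.mul_apply, inv_mul_cancel, RingAut.one_apply]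
  have hTS : ∀ x, (F ^ (t : ℤ)) (F x) = F ((F ^ (t : ℤ)) x) := fun x => by
    rw [← RingAut.mul_apply, ← RingAut.mul_apply, ← zpow_add_one, ← zpow_one_add, add_comm]
  have hTP : ∀ x, (F ^ (t : ℤ)) (F⁻¹ x) = F⁻¹ ((F ^ (t : ℤ)) x) := fun x => by
    rw [← hPS ((F ^ (t : ℤ)) (F⁻¹ x)), ← hTS, hSP]
  have hη2 : η * η = 1 := by rcases hη with rfl | rfl <;> ring
  have hθ2 : θ * θ = 1 := by rcases hθ with rfl | rfl <;> ring
  have hη0 : η ≠ 0 := left_ne_zero_of_mul_eq_one hη2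
  have hθ0 : θ ≠ 0 := left_ne_zero_of_mul_eq_one hθ2
  have Sη : F η = η := by rcases hη with rfl | rfl <;> simp
  have Pη : F⁻¹ η = η := by rcases hη with rfl | rfl <;> simp
  have S0 : ∀ {x : K}, x ≠ 0 → F x ≠ 0 := fun hx => (map_ne_zero F).mpr hx
  have P0 : ∀ {x : K}, x ≠ 0 → F⁻¹ x ≠ 0 := fun hx => (map_ne_zero F⁻¹).mpr hx
  have hSω := S0 hω
  have hPω := P0 hω
  have hPPω := P0 hPω
  have hSk := S0 hk
  have hPk := P0 hk
  have hPμ := P0 hμ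
  have hTPω : (F ^ (t : ℤ)) (F⁻¹ ω) = -F⁻¹ ω := by rw [hTP, hTω, map_neg]
  have hTSω : (F ^ (t : ℤ)) (F ω) = -F ω := by rw [hTS, hTω, map_neg]
  have hTPPω : (F ^ (t : ℤ)) (F⁻¹ (F⁻¹ ω)) = -F⁻¹ (F⁻¹ ω) := by rw [hTP, hTPω, map_neg]
  have hTSk : (F ^ (t : ℤ)) (F k) = η / F k := by rw [hTS, hTk, map_div₀, Sη]
  have hTPk : (F ^ (t : ℤ)) (F⁻¹ k) = η / F⁻¹ k := by rw [hTP, hTk, map_div₀, Pη]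
  have hμ' : F⁻¹ ω / (μ * F ω) ≠ 0 := div_ne_zero hPω (mul_ne_zero hμ hSω)
  have key := family_equiv F ht hF (k := k⁻¹) (μ := F⁻¹ ω / (μ * F ω)) hε hη hθ hh
    (inv_ne_zero hk) hm hμ' hTh (by rw [map_inv₀, hTk]; field_simp; linear_combination -hη2) hTm
    (by rw [map_div₀, map_mul, hTPω, hTSω, hTμ, mul_neg, neg_div_neg_eq]) hκ hψ
    (fun _ => rfl)
    (H.rescale (r := θ * k * μ / F⁻¹ ω) (e := ω / k)
      (div_ne_zero (mul_ne_zero (mul_ne_zero hθ0 hk) hμ) hPω) (div_ne_zero hω hk) (fun x => by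
        rw [hφ]
        simp only [pairTerm, zpow_one, zpow_neg_one, map_mul, map_div₀, map_inv₀, hTSω, hTPω,
          hTSk, hTPk]
        field_simp
        linear_combination -(η * F k * (F ^ (t : ℤ)) (F x) + η * F k * μ * F⁻¹ x) * hθ2 -
          F k * μ * θ * k * F⁻¹ k * (F ^ (t : ℤ)) (F⁻¹ x) * hη2))
  rw [div_inv_eq_mul] at key
  refine ⟨key.1, key.2.imp ?_ ?_⟩
  · rintro ⟨z, hz, h1, h2⟩
    -- The factor `ω` absorbs the part of the new `μ` that depends on `ω`, and it reverses the sign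
    -- in the equation for `T z`; `F ω` does the same in the other alternative.
    refine ⟨z * ω, mul_ne_zero hz hω, ?_, ?_⟩
    · rw [map_mul, h1, hTω]; ring
    · rw [map_div₀, map_mul, hPS] at h2
      rw [map_mul, map_mul, map_mul, hTPPω]
      field_simp at h2 ⊢
      linear_combination h2
  · rintro ⟨z, hz, h1, h2⟩
    refine ⟨z * F ω, mul_ne_zero hz hSω, ?_, ?_⟩
    · rw [map_mul, h1, hTSω]; ring
    · rw [map_mul, map_mul, map_mul, hPS, hTPω]
      field_simp at h2 ⊢
      linear_combination h2

/-- Dividing `z` by `S μ` leaves `T z / z` unchanged and multiplies `T (P (P z)) / z` by `S μ / P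
μ`. -/
theorem exists_twist {S P T : RingAut K} (hPS : ∀ x, P (S x) = x) (hTS : ∀ x, T (S x) = S (T x))
    (hTP : ∀ x, T (P x) = P (T x)) {m μ r δ : K} (hμ : μ ≠ 0) (hTμ : T μ = μ)
    (H : ∃ z : K, z ≠ 0 ∧ T z = r * z ∧ m * P μ = δ * (T (P (P z)) / z)) :
    ∃ z : K, z ≠ 0 ∧ T z = r * z ∧ m * S μ = δ * (T (P (P z)) / z) := by
  obtain ⟨z, hz, h1, h2⟩ := H
  have hSμ : S μ ≠ 0 := (map_ne_zero S).mpr hμ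
  have hPμ : P μ ≠ 0 := (map_ne_zero P).mpr hμ
  refine ⟨z / S μ, div_ne_zero hz hSμ, ?_, ?_⟩
  · rw [map_div₀, h1, hTS, hTμ]; ring
  · rw [map_div₀, map_div₀, map_div₀, hPS, hTP μ, hTμ]
    field_simp at h2 ⊢
    linear_combination h2

end Main

end ScatteredQuad

/-! ### The theorem: reduction of the congruences to the normal forms -/

open ScatteredQuad

theorem theorem4p3 {K : Type*} [Field K] [Finite K] (q t s ℓ : ℕ)
    (hq : IsPrimePow q) (hodd : Odd q) (ht : 5 ≤ t) (hK : Nat.card K = q ^ (2 * t))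
    (hs0 : 0 < s) (hs : Nat.gcd s (2 * t) = 1) (hl0 : 0 < ℓ) (hl : Nat.gcd ℓ (2 * t) = 1)
    (m h μ k : K)
    (hmh : ScatteredQuad.Admissible q t m h s) (hμk : ScatteredQuad.Admissible q t μ k ℓ) :
    -- (a)
    ((¬ (ℓ : ℤ) ≡ s [ZMOD 2 * t] → ¬ (ℓ : ℤ) ≡ -s [ZMOD 2 * t] →
        ¬ (ℓ : ℤ) ≡ t + s [ZMOD 2 * t] → ¬ (ℓ : ℤ) ≡ t - s [ZMOD 2 * t] →
        ¬ ScatteredQuad.GLEquiv (ScatteredQuad.psi q t m h s) (ScatteredQuad.psi q t μ k ℓ))) ∧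
    -- (b)
    ((ℓ : ℤ) ≡ -s [ZMOD 2 * t] →
      ScatteredQuad.GLEquiv (ScatteredQuad.psi q t m h s) (ScatteredQuad.psi q t μ k ℓ) →
      h * k ∈ ScatteredQuad.subF K q (Nat.gcd (t - 2) (2 * t)) ∧
      ((∃ z : K, z ^ q ^ (s * t) = (h * k) ^ (q ^ (3 * s) - 1) * z ∧
          m * μ ^ q ^ s = z ^ (q ^ (s * (t - 2)) - 1)) ∨
        (∃ z : K, z ^ q ^ (s * t) = -(h * k) ^ (q ^ (3 * s) - 1) * z ∧
          m * μ = -z ^ (q ^ (s * (t - 2)) - 1)))) ∧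
    -- (c)
    ((ℓ : ℤ) ≡ s [ZMOD 2 * t] →
      ScatteredQuad.GLEquiv (ScatteredQuad.psi q t m h s) (ScatteredQuad.psi q t μ k ℓ) →
      h / k ∈ ScatteredQuad.subF K q (Nat.gcd (t - 2) (2 * t)) ∧
      ((∃ z : K, z ^ q ^ (s * t) = -(h / k) ^ (q ^ (3 * s) - 1) * z ∧
          m * (μ ^ q ^ (s * (t - 1)))⁻¹ = -z ^ (q ^ (s * (t - 2)) - 1)) ∨
        (∃ z : K, z ^ q ^ (s * t) = (h / k) ^ (q ^ (3 * s) - 1) * z ∧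
          m / μ = z ^ (q ^ (s * (t - 2)) - 1)))) ∧
    -- (d)
    ((ℓ : ℤ) ≡ t - s [ZMOD 2 * t] →
      ScatteredQuad.GLEquiv (ScatteredQuad.psi q t m h s) (ScatteredQuad.psi q t μ k ℓ) →
      h / k ∈ ScatteredQuad.subF K q (Nat.gcd (t - 2) (2 * t)) ∧
      ((∃ z : K, z ^ q ^ (s * t) = (h / k) ^ (q ^ (3 * s) - 1) * z ∧
          m * μ ^ q ^ s = -z ^ (q ^ (s * (t - 2)) - 1)) ∨
        (∃ z : K, z ^ q ^ (s * t) = -(h / k) ^ (q ^ (3 * s) - 1) * z ∧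
          m * μ = z ^ (q ^ (s * (t - 2)) - 1)))) ∧
    -- (e)
    ((ℓ : ℤ) ≡ t + s [ZMOD 2 * t] →
      ScatteredQuad.GLEquiv (ScatteredQuad.psi q t m h s) (ScatteredQuad.psi q t μ k ℓ) →
      h * k ∈ ScatteredQuad.subF K q (Nat.gcd (t - 2) (2 * t)) ∧
      ((∃ z : K, z ^ q ^ (s * t) = -(h * k) ^ (q ^ (3 * s) - 1) * z ∧
          m * (μ ^ q ^ (s * (t - 1)))⁻¹ = z ^ (q ^ (s * (t - 2)) - 1)) ∨
        (∃ z : K, z ^ q ^ (s * t) = (h * k) ^ (q ^ (3 * s) - 1) * z ∧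
          m / μ = -z ^ (q ^ (s * (t - 2)) - 1)))) := by

  have hq1 : 1 < q := hq.one_lt
  have ht0 : 0 < t := by omega
  obtain ⟨F, hF, hord⟩ := exists_frobenius hq ht0 hK
  have h2 : (2 : K) ≠ 0 := two_ne_zero_of_odd_card (hK ▸ hodd.pow)
  have odd_of : ∀ n : ℕ, Nat.gcd n (2 * t) = 1 → Odd n := fun n hn =>
    Nat.coprime_two_right.mp (Nat.Coprime.coprime_mul_right_right hn)
  have hso := odd_of s hs
  have hlo := odd_of ℓ hl
  obtain ⟨ε, hε, hh, hTh, hexc⟩ := hmh.norm hq1 ht0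
  obtain ⟨η, hη, hk, hTk, -⟩ := hμk.norm hq1 ht0
  have hm := hmh.2.1
  have hμ := hμk.2.1
  have hTpow : ∀ x : K, x ^ q ^ t = (F ^ (t : ℤ)) x := pow_eq_zpow_apply hF hord (by simp)
  have hTm : (F ^ (t : ℤ)) m = m := by rw [← hTpow]; exact hmh.1
  have hTμ : (F ^ (t : ℤ)) μ = μ := by rw [← hTpow]; exact hμk.1
  rw [hTpow] at hTh hTk
  have hκ := one_add_mul_ne_zero hF hord hso hodd h2 hh hε hTh hexc
  have hψ := psi_eval hF hord ht0 hso (m := m) hh hε hTh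
  have hφ := psi_eval hF hord ht0 hlo (m := μ) hk hη hTk
  have hFe : ∀ a b : ℤ, (2 * t : ℤ) ∣ a - b → F ^ a = F ^ b := fun a b hab => by
    rw [← mul_inv_eq_one, ← zpow_sub]
    apply orderOf_dvd_iff_zpow_eq_one.mp
    rw [hord]; exact_mod_cast hab
  refine ⟨fun n1 n2 n3 n4 H => ?_, ?_⟩
  · have hdvd : ∀ n : ℕ, Nat.gcd n (2 * t) = 1 → ¬ (t : ℤ) ∣ n := fun n hn hd => by
      have h1 : t ∣ Nat.gcd n (2 * t) := Nat.dvd_gcd (Int.natCast_dvd_natCast.mp hd) ⟨2, by ring⟩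
      rw [hn] at h1
      have := Nat.le_of_dvd one_pos h1
      omega
    have hpar : ∀ j : ℤ, (∃ i, j = 2 * i) ∨ ∃ i, j = 2 * i + 1 := fun j => by
      rcases Int.even_or_odd' j with ⟨i, h | h⟩
      · exact Or.inl ⟨i, h⟩
      · exact Or.inr ⟨i, h⟩
    refine not_planeEquiv F hord ht0 hh hm hε hTh hκ hψ hφ (hdvd s hs) ?_ (hdvd ℓ hl) ?_ ?_
      H.planeEquiv
    · intro hd
      have h1 : t ∣ 2 * s := by exact_mod_cast hd
      have h3 : Nat.Coprime t s := (Nat.Coprime.coprime_mul_left_right hs).symm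
      have := Nat.le_of_dvd two_pos (h3.dvd_of_dvd_mul_right h1)
      omega
    -- A congruence modulo `t` is one of two modulo `2t`, according to the parity of `j`.
    · rintro ⟨j, hj⟩
      rcases hpar j with ⟨i, rfl⟩ | ⟨i, rfl⟩
      · exact n1 (Int.modEq_iff_dvd.mpr ⟨-i, by linear_combination -hj⟩)
      · exact n3 (Int.modEq_iff_dvd.mpr ⟨-i, by linear_combination -hj⟩)
    · rintro ⟨j, hj⟩
      rcases hpar j with ⟨i, rfl⟩ | ⟨i, rfl⟩
      · exact n2 (Int.modEq_iff_dvd.mpr ⟨-i, by linear_combination -hj⟩)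
      · exact n4 (Int.modEq_iff_dvd.mpr ⟨-i, by linear_combination -hj⟩)
  -- `G = F ^ s` again generates the group of powers of `F`, so in terms of `G` the parameter `s`
  -- becomes `1`.
  obtain ⟨G, hG⟩ : ∃ G, G = F ^ (s : ℤ) := ⟨_, rfl⟩
  have hGinv : F ^ (-(s : ℤ)) = G⁻¹ := by rw [hG, zpow_neg]
  have hordG : orderOf G = 2 * t := by
    rw [hG, zpow_natCast, Nat.Coprime.orderOf_pow (by rw [hord]; exact Nat.Coprime.symm hs), hord]
  have hGt : F ^ (t : ℤ) = G ^ (t : ℤ) := by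
    rw [hG, ← zpow_mul]
    apply hFe
    obtain ⟨r, rfl⟩ := hso
    exact ⟨-r, by push_cast; ring⟩
  have hsub : ∀ x, G (G x) = (G ^ (t : ℤ)) x →
      x ∈ ScatteredQuad.subF K q (Nat.gcd (t - 2) (2 * t)) := fun x hx =>
    mem_subF_of_fixed hF hord hs (by omega) hso (by rwa [← hG, hGt])
  obtain ⟨T, hTdef⟩ : ∃ T, T = G ^ (t : ℤ) := ⟨_, rfl⟩
  have hPS : ∀ x, G⁻¹ (G x) = x := fun x => by
    rw [← RingAut.mul_apply, inv_mul_cancel, RingAut.one_apply]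
  have hSP : ∀ x, G (G⁻¹ x) = x := fun x => by
    rw [← RingAut.mul_apply, mul_inv_cancel, RingAut.one_apply]
  have hTS : ∀ x, T (G x) = G (T x) := fun x => by
    rw [hTdef, ← RingAut.mul_apply, ← RingAut.mul_apply, ← zpow_add_one, ← zpow_one_add, add_comm]
  have hTP : ∀ x, T (G⁻¹ x) = G⁻¹ (T x) := fun x => by
    rw [← hPS (T (G⁻¹ x)), ← hTS, hSP]
  have hTT : ∀ x, T (T x) = x := fun x => by
    rw [hTdef, ← hGt, ← RingAut.mul_apply, ← zpow_add, hFe (t + t) 0 ⟨1, by ring⟩, zpow_zero,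
      RingAut.one_apply]
  have hFt : F ^ (t : ℤ) = T := hGt.trans hTdef.symm
  have hzT : ∀ z : K, z ^ q ^ (s * t) = T z := fun z => by
    rw [hTdef, hG, ← zpow_mul]
    exact pow_eq_zpow_apply hF hord (by simp) z
  have hq3 : ∀ x : K, x ≠ 0 → x ^ (q ^ (3 * s) - 1) = G (G (G x)) / x := fun x hx => by
    rw [pow_sub_one_eq_div hx (by omega), pow_eq_zpow_apply hF hord (e := s + s + s)
      ⟨0, by push_cast; ring⟩, zpow_add, zpow_add, hG, RingAut.mul_apply, RingAut.mul_apply]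
  have hq2 : ∀ x : K, x ≠ 0 → x ^ (q ^ (s * (t - 2)) - 1) = T (G⁻¹ (G⁻¹ x)) / x := fun x hx => by
    rw [pow_sub_one_eq_div hx (by omega), pow_eq_zpow_apply hF hord (e := s * t + -s + -s)
      ⟨0, by push_cast [Nat.cast_sub (show 2 ≤ t by omega)]; ring⟩, zpow_add, zpow_add, hTdef,
      RingAut.mul_apply, RingAut.mul_apply, zpow_mul, ← hG, hGinv]
  have hμs : μ ^ q ^ s = G μ := by
    rw [hG]; exact pow_eq_zpow_apply hF hord (by simp) μ
  have hμt : μ ^ q ^ (s * (t - 1)) = G⁻¹ μ := by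
    rw [pow_eq_zpow_apply hF hord (e := -s + s * t)
      ⟨0, by push_cast [Nat.cast_sub (show 1 ≤ t by omega)]; ring⟩, zpow_add, zpow_mul, ← hG,
      RingAut.mul_apply, ← hGt, hTμ, hGinv]
  rw [hFt] at hTh hTk hTm hTμ
  rw [← hG] at hκ
  have hψ' : ∀ x, (psi q t m h s).eval x = pairTerm G t m (-(m * ε * h * G h)) 1 x
      + pairTerm G t (h / G⁻¹ h) 1 (-1) x := fun x => by
    rw [hψ]
    simp only [pairTerm, ← hGt, hGinv, ← hG, zpow_one, zpow_neg_one]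
  have hη2 : η * η = 1 := by rcases hη with rfl | rfl <;> ring
  have hη0 : η ≠ 0 := left_ne_zero_of_mul_eq_one hη2
  have Gη : G η = η := by rcases hη with rfl | rfl <;> simp
  have Pη : G⁻¹ η = η := by rcases hη with rfl | rfl <;> simp
  have hGk : G k ≠ 0 := (map_ne_zero G).mpr hk
  have hPk : G⁻¹ k ≠ 0 := (map_ne_zero G⁻¹).mpr hk
  have hTGk : T (G k) = η / G k := by rw [hTS, hTk, map_div₀, Gη]
  have hTPk : T (G⁻¹ k) = η / G⁻¹ k := by rw [hTP, hTk, map_div₀, Pη]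
  have hTμi : T μ⁻¹ = μ⁻¹ := by rw [map_inv₀, hTμ]
  have hhk := mul_ne_zero hh hk
  have hhk' := div_ne_zero hh hk
  refine ⟨fun hls H => ?_, fun hls H => ?_, fun hls H => ?_, fun hls H => ?_⟩
  · have e1 : F ^ (ℓ : ℤ) = G⁻¹ := by
      rw [← hGinv]; exact hFe _ _ hls.symm.dvd
    have e2 : F ^ (-(ℓ : ℤ)) = G := by rw [zpow_neg, e1, inv_inv]
    obtain ⟨hR, hz⟩ := family_equiv_inv G ht hordG (θ := 1) hε hη (Or.inl rfl) hh hk hm hμ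
      (hTdef ▸ hTh) (hTdef ▸ hTk) (hTdef ▸ hTm) (hTdef ▸ hTμ) hκ hψ' (fun x => by
        rw [hφ]
        simp only [pairTerm, ← hTdef, hFt, e1, e2, zpow_one, zpow_neg_one]
        ring) H.planeEquiv
    rw [← hTdef] at hz
    refine ⟨hsub _ hR, hz.imp (fun hz => ?_) ?_⟩
    · obtain ⟨z, hz0, h1, h3⟩ := exists_twist (r := G (G (G (h * k))) / (h * k)) (δ := 1)
        hPS hTS hTP hμ hTμ (by simpa only [one_mul] using hz)
      refine ⟨z, ?_, ?_⟩
      · rw [hzT, hq3 _ hhk, h1]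
      · rw [hμs, hq2 z hz0, h3, one_mul]
    · rintro ⟨z, hz0, h1, h3⟩
      refine ⟨z, ?_, ?_⟩
      · rw [hzT, hq3 _ hhk, h1, neg_one_mul]
      · rw [hq2 z hz0, h3]
  · have e1 : F ^ (ℓ : ℤ) = G := by
      rw [hG]; exact hFe _ _ hls.symm.dvd
    have e2 : F ^ (-(ℓ : ℤ)) = G⁻¹ := by rw [zpow_neg, e1]
    obtain ⟨hR, hz⟩ := family_equiv G ht hordG (θ := 1) hε hη (Or.inl rfl) hh hk hm hμ
      (hTdef ▸ hTh) (hTdef ▸ hTk) (hTdef ▸ hTm) (hTdef ▸ hTμ) hκ hψ' (fun x => by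
        rw [hφ]
        simp only [pairTerm, ← hTdef, hFt, e1, e2, zpow_one, zpow_neg_one]
        ring) H.planeEquiv
    rw [← hTdef] at hz
    refine ⟨hsub _ hR, hz.imp ?_ ?_⟩
    · rintro ⟨z, hz0, h1, h3⟩
      refine ⟨z, ?_, ?_⟩
      · rw [hzT, hq3 _ hhk', h1, neg_one_mul]
      · rw [hμt, hq2 z hz0, ← h3, div_eq_mul_inv]
    · rintro ⟨z, hz0, h1, h3⟩
      refine ⟨z, ?_, ?_⟩
      · rw [hzT, hq3 _ hhk', h1, one_mul]
      · rw [hq2 z hz0, h3]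
  · have e1 : F ^ (ℓ : ℤ) = T * G⁻¹ := by
      rw [← hGinv, ← hFt, ← zpow_add]; exact hFe _ _ hls.symm.dvd
    have e2 : F ^ (-(ℓ : ℤ)) = T * G := by
      rw [hG, ← hFt, ← zpow_add]
      apply hFe
      obtain ⟨j, hj⟩ := hls.dvd
      exact ⟨j - 1, by linear_combination hj⟩
    -- The shift by `t` exchanges the two members of each pair. Taking out the factor `μ` restores
    -- the normal form with `μ⁻¹`, and the minus sign in `ψ` moves to the other class as `θ = -1`.
    obtain ⟨hR, hz⟩ := family_equiv G ht hordG (θ := -1) hε hη (Or.inr rfl) hh hk hm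
      (inv_ne_zero hμ) (hTdef ▸ hTh) (hTdef ▸ hTk) (hTdef ▸ hTm) (hTdef ▸ hTμi) hκ hψ'
      (fun _ => rfl)
      (H.planeEquiv.rescale (r := μ) (e := 1) hμ one_ne_zero (fun x => by
        rw [hφ]
        simp only [pairTerm, ← hTdef, hFt, e1, e2, zpow_one, zpow_neg_one, RingAut.mul_apply, hTT,
          hTGk, hTPk, one_mul]
        field_simp
        linear_combination -(μ * η * k * G⁻¹ x + G⁻¹ k * k * G k * T (G x)) * hη2))
    rw [← hTdef] at hz
    refine ⟨hsub _ hR, hz.imp (fun hz => ?_) ?_⟩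
    · obtain ⟨z, hz0, h1, h3⟩ := exists_twist (r := G (G (G (h / k))) / (h / k)) (δ := -1)
        hPS hTS hTP hμ hTμ (by
          simpa only [neg_neg, one_mul, neg_one_mul, map_inv₀, div_inv_eq_mul] using hz)
      refine ⟨z, ?_, ?_⟩
      · rw [hzT, hq3 _ hhk', h1]
      · rw [hμs, hq2 z hz0, h3, neg_one_mul]
    · rintro ⟨z, hz0, h1, h3⟩
      refine ⟨z, ?_, ?_⟩
      · rw [hzT, hq3 _ hhk', h1, neg_one_mul]
      · rw [hq2 z hz0, ← h3, div_inv_eq_mul]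
  · have e1 : F ^ (ℓ : ℤ) = T * G := by
      rw [hG, ← hFt, ← zpow_add]; exact hFe _ _ hls.symm.dvd
    have e2 : F ^ (-(ℓ : ℤ)) = T * G⁻¹ := by
      rw [← hGinv, ← hFt, ← zpow_add]
      apply hFe
      obtain ⟨j, hj⟩ := hls.dvd
      exact ⟨j - 1, by linear_combination hj⟩
    -- The same normalization by `μ`, now for the form with exchanged classes.
    obtain ⟨hR, hz⟩ := family_equiv_inv G ht hordG (θ := -1) hε hη (Or.inr rfl) hh hk hm
      (inv_ne_zero hμ) (hTdef ▸ hTh) (hTdef ▸ hTk) (hTdef ▸ hTm) (hTdef ▸ hTμi) hκ hψ'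
      (fun _ => rfl)
      (H.planeEquiv.rescale (r := μ) (e := 1) hμ one_ne_zero (fun x => by
        rw [hφ]
        simp only [pairTerm, ← hTdef, hFt, e1, e2, zpow_one, zpow_neg_one, RingAut.mul_apply, hTT,
          hTGk, hTPk, one_mul]
        field_simp
        linear_combination -(μ * η * k * G x + G k * k * G⁻¹ k * T (G⁻¹ x)) * hη2))
    rw [← hTdef] at hz
    refine ⟨hsub _ hR, hz.imp ?_ ?_⟩
    · rintro ⟨z, hz0, h1, h3⟩
      refine ⟨z, ?_, ?_⟩
      · rw [hzT, hq3 _ hhk, h1, neg_one_mul]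
      · rw [hμt, hq2 z hz0, ← h3, map_inv₀]
    · rintro ⟨z, hz0, h1, h3⟩
      refine ⟨z, ?_, ?_⟩
      · rw [hzT, hq3 _ hhk, h1, neg_neg, one_mul]
      · rw [hq2 z hz0, ← h3, div_eq_mul_inv]
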